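/- Let $\{X(t), t\ge 0\}$ be a centered Gaussian process with almost surely continuous sample paths, stationary increments and $X(0)=0$ almost surely, and suppose that its variance function $V(t)=\sigma^2(t)=\operatorname{Var}(X(t))$ is differentiable, strictly increasing and convex on $[0,\infty)$. Let $c>0$, $S>0$ and $T>0$ be constants and, for $u>0$, put $$\mathcal P_S(u,T)=\mathbb P\Bigl(\inf_{t\in[0,S]}\ \sup_{s\in[t,t+T]}\bigl(u+cs-X(s)\bigr)<0\Bigr).$$ Then, as $u\to\infty$, $$\mathcal P_S(u,T)\ \ge\ C_{c,\Delta}\,\frac{\sigma^2(S)}{u}\,\Psi\!\left(\frac{u+cS}{\sigma(S)}\right)(1+o(1)),$$ that is, there is a function $r$ with $r(u)\to 0$ as $u\to\infty$ such that the inequality holds with $1+r(u)$ in place of $1+o(1)$ for all sufficiently large $u$. Here $$C_{c,\Delta}=\frac{2}{\sqrt\Delta}\,\varphi\!\left(\frac{c\sqrt\Delta}{V'(S)}\right)-\frac{2c}{V'(S)}\,\Psi\!\left(\frac{c\sqrt\Delta}{V'(S)}\right),\qquad \Delta=\sigma^2(S+T)-\sigma^2(S),$$ and $\varphi$ and $\Psi(x)=\mathbb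 P(N>x)$ are the density and the tail distribution function of a standard normal random variable $N$. -/

import Mathlib

open MeasureTheory ProbabilityTheory Filter Topology
open scoped NNReal

noncomputable section

namespace ParisianRuin

/-- A real-valued process on `[0, ∞)` has stationary increments: for every shift `h`, the
finite-dimensional distributions of `t ↦ X (t + h) - X h` are those of `t ↦ X t - X 0`. -/
def HasStationaryIncrements {Ω : Type*} [MeasurableSpace Ω]
    (X : ℝ≥0 → Ω → ℝ) (P : Measure Ω) : Prop :=
  ∀ (h : ℝ≥0) (I : Finset ℝ≥0),
    IdentDistrib (fun ω ↦ I.restrict (fun t ↦ X (t + h) ω - X h ω))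
      (fun ω ↦ I.restrict (fun t ↦ X t ω - X 0 ω)) P P

/-- The variance function `V(t) = σ²(t)` of the process, as a function of a real variable
(only its values for `t ≥ 0` are meaningful). -/
def varianceFun {Ω : Type*} [MeasurableSpace Ω]
    (X : ℝ≥0 → Ω → ℝ) (P : Measure Ω) (t : ℝ) : ℝ :=
  variance (X t.toNNReal) P

/-- The surplus `R_u(t) = u + c t - X(t)`. -/
def surplus {Ω : Type*} (X : ℝ≥0 → Ω → ℝ) (c u : ℝ) (t : ℝ≥0) (ω : Ω) : ℝ :=
  u + c * t - X t ω

/-- The probability of Parisian ruin over `[0, S]`,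
`P (inf_{t ∈ [0,S]} sup_{s ∈ [t,t+T]} R_u(s) < 0)`. For continuous paths, the infimum and the
suprema are over nonempty bounded sets of reals. -/
def parisianRuinProb {Ω : Type*} [MeasurableSpace Ω]
    (X : ℝ≥0 → Ω → ℝ) (P : Measure Ω) (c : ℝ) (S T : ℝ≥0) (u : ℝ) : ℝ :=
  P.real {ω | (⨅ t : Set.Icc (0 : ℝ≥0) S,
    ⨆ s : Set.Icc (t : ℝ≥0) ((t : ℝ≥0) + T), (surplus X c u s ω : ℝ)) < 0}

/-- The tail `Ψ` of the standard normal distribution. -/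
def gaussianTail (x : ℝ) : ℝ := (gaussianReal 0 1).real (Set.Ioi x)

/-- `K_{c,y} = 2 φ(c √y) / √y - 2 c Ψ(c √y)`, with `φ` the standard normal density. -/
def constK (c y : ℝ) : ℝ :=
  2 * gaussianPDFReal 0 1 (c * √y) * (1 / √y) - 2 * c * gaussianTail (c * √y)

end ParisianRuin

end

/-! Taking t = S in the infimum, ruin occurs as soon as X(s) > u + cs on all of [S, S + T], so it
suffices to bound that probability from below. By stationarity of increments, Cov(X(s), X(t)) =
(V(s) + V(t) - V(t - s)) / 2 for s ≤ t. A convex V with V(0) = 0 is superadditive, so this is at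
least V(s), the covariance of the time-changed Brownian motion B(V(·)), which has the same
variances. Slepian's inequality (`slepian`), applied on finite grids, therefore allows X to be
replaced by B(V(·)).

Convexity also gives V(t) - V(S) ≥ V'(S)(t - S) for t ≥ S. In Brownian time the boundary may thus be
raised to a straight line of slope c / V'(S), which starts at level U = u + cS at time V(S) and has
to be exceeded for a further time Δ. From height x above the line, Brownian motion succeeds with
probability `survivalFun`, and a Gaussian walk observed only at grid times does at least as well
(`survivalFun_le_pi_real`). That comparison uses only the explicit formula, its semigroup property
and its sign, so no Brownian motion is constructed.

The survival probability is at least K x - M x² with K = `constK` (`survivalFun_ge`). The overshoot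
of a Gaussian variable over a high level U is of order V(S) / U, so integrating against the density
p of B(V(S)) gives p(U) K (V(S) / U)² to leading order (`crossingBound_le`). Finally Ψ(U / σ(S)) ≤
p(U) V(S) / U (`gaussianTail_le`) turns this into the claimed form. -/

namespace ParisianRuin

/-! ### Uniform Taylor expansions of smooth increasing test functions -/

section Expansion

/-- A mean value estimate: a derivative of size `C |x| ^ n` integrates to `C |x| ^ (n + 1)`. -/
lemma abs_le_pow_succ_of_deriv_le {F F' : ℝ → ℝ} {C : ℝ} {n : ℕ} (hC : 0 ≤ C)
    (hF : ∀ x, HasDerivAt F (F' x) x) (h0 : F 0 = 0) (hb : ∀ x, |F' x| ≤ C * |x| ^ n) (x : ℝ) :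
    |F x| ≤ C * |x| ^ (n + 1) := by
  have key := Convex.norm_image_sub_le_of_norm_hasDerivWithin_le (f := F) (f' := F')
    (s := Set.uIcc 0 x) (x := 0) (y := x) (C := C * |x| ^ n)
    (fun y _ ↦ (hF y).hasDerivWithinAt) (fun y hy ↦ ?_) (convex_uIcc 0 x) (by simp) (by simp)
  · rw [h0] at key
    simp only [sub_zero, Real.norm_eq_abs] at key
    calc |F x| ≤ C * |x| ^ n * |x| := key
      _ = C * |x| ^ (n + 1) := by ring
  · refine (hb y).trans ?_
    have : |y| ≤ |x| := by simpa using Set.abs_sub_left_of_mem_uIcc hy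
    gcongr

/-- The derivative of the smooth transition function has compact support. -/
lemma hasCompactSupport_deriv_smoothTransition :
    HasCompactSupport (deriv Real.smoothTransition) := by
  refine HasCompactSupport.intro (isCompact_Icc (a := (0 : ℝ)) (b := 1)) fun x hx ↦ ?_
  rw [Set.mem_Icc, not_and_or, not_le, not_le] at hx
  rcases hx with hx | hx
  · have : Real.smoothTransition =ᶠ[𝓝 x] fun _ ↦ 0 := by
      filter_upwards [Iio_mem_nhds hx] with y hy
      exact Real.smoothTransition.zero_of_nonpos (le_of_lt hy)
    rw [this.deriv_eq]; simp
  · have : Real.smoothTransition =ᶠ[𝓝 x] fun _ ↦ 1 := by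
      filter_upwards [Ioi_mem_nhds hx] with y hy
      exact Real.smoothTransition.one_of_one_le (le_of_lt hy)
    rw [this.deriv_eq]; simp

/-- The derivatives are continuous with compact support, hence bounded. Integrating the bound on the
third derivative three times from the base point gives a cubic remainder, uniform in `z`. -/
lemma smoothTransition_expansion : ∃ C, 0 ≤ C ∧ ∀ z, ∃ a b, 0 ≤ a ∧ a ≤ C ∧ |b| ≤ C ∧
    ∀ h, |Real.smoothTransition (z + h) - Real.smoothTransition z - a * h - b * h ^ 2|
      ≤ C * |h| ^ 3 := by
  set g := Real.smoothTransition
  have hg : ContDiff ℝ 4 g := Real.smoothTransition.contDiff (n := 4)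
  have hg1 : ContDiff ℝ 3 (deriv g) := by
    have : ContDiff ℝ (3 + 1) g := by convert! hg using 1
    exact this.deriv'
  have hg2 : ContDiff ℝ 2 (deriv (deriv g)) := by
    have : ContDiff ℝ (2 + 1) (deriv g) := by convert! hg1 using 1
    exact this.deriv'
  have hg3 : ContDiff ℝ 1 (deriv (deriv (deriv g))) := by
    have : ContDiff ℝ (1 + 1) (deriv (deriv g)) := by convert! hg2 using 1
    exact this.deriv'
  have hs1 : HasCompactSupport (deriv g) := hasCompactSupport_deriv_smoothTransition
  obtain ⟨C1, hC1⟩ := hs1.exists_bound_of_continuous hg1.continuous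
  obtain ⟨C2, hC2⟩ := hs1.deriv.exists_bound_of_continuous hg2.continuous
  obtain ⟨C3, hC3⟩ := hs1.deriv.deriv.exists_bound_of_continuous hg3.continuous
  have p1 := (norm_nonneg _).trans (hC1 0)
  have p2 := (norm_nonneg _).trans (hC2 0)
  have p3 := (norm_nonneg _).trans (hC3 0)
  refine ⟨C1 + C2 + C3, by positivity, fun z ↦ ⟨deriv g z, deriv (deriv g) z / 2, ?_, ?_, ?_, ?_⟩⟩
  · exact Real.smoothTransition.monotone.deriv_nonneg
  · have := (le_abs_self _).trans (hC1 z); linarith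
  · have := hC2 z
    rw [Real.norm_eq_abs] at this
    rw [abs_div, abs_two]
    linarith
  · have d0 : ∀ x, HasDerivAt g (deriv g x) x := fun x ↦
      (hg.differentiable (by norm_num) x).hasDerivAt
    have d1 : ∀ x, HasDerivAt (deriv g) (deriv (deriv g) x) x := fun x ↦
      (hg1.differentiable (by norm_num) x).hasDerivAt
    have d2 : ∀ x, HasDerivAt (deriv (deriv g)) (deriv (deriv (deriv g)) x) x := fun x ↦
      (hg2.differentiable (by norm_num) x).hasDerivAt
    have e2 : ∀ h, |deriv (deriv g) (z + h) - deriv (deriv g) z| ≤ C3 * |h| ^ 1 := by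
      refine abs_le_pow_succ_of_deriv_le (n := 0)
        (F' := fun h ↦ deriv (deriv (deriv g)) (z + h)) p3 (fun x ↦ ?_) (by simp) (fun x ↦ ?_)
      · exact ((d2 (z + x)).comp_const_add z x).sub_const _
      · simpa using hC3 (z + x)
    have e1 : ∀ h, |deriv g (z + h) - deriv g z - deriv (deriv g) z * h| ≤ C3 * |h| ^ 2 := by
      refine abs_le_pow_succ_of_deriv_le (n := 1) p3 (fun x ↦ ?_) (by simp) e2
      have := ((d1 (z + x)).comp_const_add z x).sub_const (deriv g z)
      convert! this.sub ((hasDerivAt_id x).const_mul (deriv (deriv g) z)) using 1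
      simp
    have e0 : ∀ h, |g (z + h) - g z - deriv g z * h - deriv (deriv g) z / 2 * h ^ 2|
        ≤ C3 * |h| ^ 3 := by
      refine abs_le_pow_succ_of_deriv_le (n := 2) p3 (fun x ↦ ?_) (by simp) e1
      have := ((d0 (z + x)).comp_const_add z x).sub_const (g z)
      convert! (this.sub ((hasDerivAt_id x).const_mul (deriv g z))).sub
        ((hasDerivAt_pow 2 x).const_mul (deriv (deriv g) z / 2)) using 1
      simp; ring
    intro h
    refine (e0 h).trans ?_
    gcongr
    linarith

variable {ι : Type*} [Fintype ι]

/-- `f` takes values in `[0, 1]` and has, uniformly in the base point, a second order expansion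
with bounded coefficients, whose gradient and off-diagonal second order part are nonnegative. -/
def HasMonotoneExpansion (f : (ι → ℝ) → ℝ) : Prop :=
  (∀ z, 0 ≤ f z) ∧ (∀ z, f z ≤ 1) ∧ ∃ C, 0 ≤ C ∧ ∀ z, ∃ (a : ι → ℝ) (b : ι → ι → ℝ),
    (∀ i, 0 ≤ a i) ∧ (∀ i, a i ≤ C) ∧ (∀ i j, i ≠ j → 0 ≤ b i j) ∧ (∀ i j, |b i j| ≤ C) ∧
    ∀ h : ι → ℝ, ‖h‖ ≤ 1 →
      |f (z + h) - f z - ∑ i, a i * h i - ∑ i, ∑ j, b i j * (h i * h j)| ≤ C * ‖h‖ ^ 3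

lemma abs_sum_mul_le {a : ι → ℝ} {C : ℝ} (ha : ∀ i, |a i| ≤ C) (h : ι → ℝ) :
    |∑ i, a i * h i| ≤ Fintype.card ι * C * ‖h‖ := by
  calc |∑ i, a i * h i| ≤ ∑ i, |a i * h i| := Finset.abs_sum_le_sum_abs _ _
    _ ≤ ∑ _i : ι, C * ‖h‖ := by
        refine Finset.sum_le_sum fun i _ ↦ ?_
        rw [abs_mul]
        exact mul_le_mul (ha i) (norm_le_pi_norm h i) (abs_nonneg _) ((abs_nonneg _).trans (ha i))
    _ = Fintype.card ι * C * ‖h‖ := by simp [mul_assoc]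

lemma abs_sum_sum_mul_le {b : ι → ι → ℝ} {C : ℝ} (hb : ∀ i j, |b i j| ≤ C) (h : ι → ℝ) :
    |∑ i, ∑ j, b i j * (h i * h j)| ≤ Fintype.card ι * (Fintype.card ι * C) * ‖h‖ ^ 2 := by
  calc |∑ i, ∑ j, b i j * (h i * h j)| ≤ ∑ i, ∑ j, |b i j * (h i * h j)| :=
        (Finset.abs_sum_le_sum_abs _ _).trans
          (Finset.sum_le_sum fun i _ ↦ Finset.abs_sum_le_sum_abs _ _)
    _ ≤ ∑ _i : ι, ∑ _j : ι, C * ‖h‖ ^ 2 := by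
        refine Finset.sum_le_sum fun i _ ↦ Finset.sum_le_sum fun j _ ↦ ?_
        rw [abs_mul, abs_mul, pow_two]
        refine mul_le_mul (hb i j) ?_ (by positivity) ((abs_nonneg _).trans (hb i j))
        exact mul_le_mul (norm_le_pi_norm h i) (norm_le_pi_norm h j) (abs_nonneg _)
          (norm_nonneg _)
    _ = Fintype.card ι * (Fintype.card ι * C) * ‖h‖ ^ 2 := by simp [mul_assoc]

lemma abs_product_expansion_le {f g F G A B A' B' K r : ℝ} (hr : 0 ≤ r) (hr1 : r ≤ 1) (hK : 1 ≤ K)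
    (hF : |F| ≤ 1) (hG : |G| ≤ 1) (hA : |A| ≤ K * r) (hB : |B| ≤ K * r ^ 2)
    (hA' : |A'| ≤ K * r) (hB' : |B'| ≤ K * r ^ 2)
    (hR : |F - f - A - B| ≤ K * r ^ 3) (hR' : |G - g - A' - B'| ≤ K * r ^ 3) :
    |F * G - f * g - (g * A + f * A') - (g * B + f * B' + A * A')| ≤ 6 * K ^ 2 * r ^ 3 := by
  have hK0 : 0 ≤ K := by linarith
  -- With remainders R and R', FG - (F - R)(G - R') = RG + FR' - RR'. The other terms are the
  -- products of order at least three in (f + A + B)(g + A' + B').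
  have e : F * G - f * g - (g * A + f * A') - (g * B + f * B' + A * A')
      = (F - f - A - B) * G + F * (G - g - A' - B') - (F - f - A - B) * (G - g - A' - B')
        + (A * B' + B * A') + B * B' := by ring
  have e1 : |(F - f - A - B) * G| ≤ K * r ^ 3 := by
    rw [abs_mul]; nlinarith [abs_nonneg (F - f - A - B), abs_nonneg G]
  have e2 : |F * (G - g - A' - B')| ≤ K * r ^ 3 := by
    rw [abs_mul]; nlinarith [abs_nonneg (G - g - A' - B'), abs_nonneg F]
  have e3 : |(F - f - A - B) * (G - g - A' - B')| ≤ K * r ^ 3 * (K * r ^ 3) := by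
    rw [abs_mul]; exact mul_le_mul hR hR' (abs_nonneg _) (by positivity)
  have e4 : |A * B'| ≤ K * r * (K * r ^ 2) := by
    rw [abs_mul]; exact mul_le_mul hA hB' (abs_nonneg _) (by positivity)
  have e5 : |B * A'| ≤ K * r ^ 2 * (K * r) := by
    rw [abs_mul]; exact mul_le_mul hB hA' (abs_nonneg _) (by positivity)
  have e6 : |B * B'| ≤ K * r ^ 2 * (K * r ^ 2) := by
    rw [abs_mul]; exact mul_le_mul hB hB' (abs_nonneg _) (by positivity)
  have h1 : K * r ^ 3 ≤ K ^ 2 * r ^ 3 := by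
    gcongr; nlinarith
  have h2 : r ^ 4 ≤ r ^ 3 := pow_le_pow_of_le_one hr hr1 (by norm_num)
  have h3 : r ^ 6 ≤ r ^ 3 := pow_le_pow_of_le_one hr hr1 (by norm_num)
  have h4 : K ^ 2 * r ^ 4 ≤ K ^ 2 * r ^ 3 := by gcongr
  have h5 : K ^ 2 * r ^ 6 ≤ K ^ 2 * r ^ 3 := by gcongr
  rw [e, abs_le]
  rw [abs_le] at e1 e2 e3 e4 e5 e6
  constructor <;> nlinarith

lemma HasMonotoneExpansion.one : HasMonotoneExpansion (fun _ : ι → ℝ ↦ 1) :=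
  ⟨by simp, by simp, 0, le_rfl, fun _ ↦ ⟨0, 0, by simp, by simp, by simp, by simp, by simp⟩⟩

/-- The second order part of the product contains the cross terms a i * a' j. Their sign is the
reason for requiring a nonnegative gradient in `HasMonotoneExpansion`. -/
lemma HasMonotoneExpansion.mul {f g : (ι → ℝ) → ℝ} (hf : HasMonotoneExpansion f)
    (hg : HasMonotoneExpansion g) : HasMonotoneExpansion (fun z ↦ f z * g z) := by
  obtain ⟨f0, f1, C, hC, hf⟩ := hf
  obtain ⟨g0, g1, D, hD, hg⟩ := hg
  set N : ℝ := (Fintype.card ι : ℝ)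
  have hN : 0 ≤ N := Nat.cast_nonneg _
  -- A single constant dominating all the coefficient bounds of both factors.
  set K : ℝ := 1 + (1 + N) ^ 2 * (C + D) with hKdef
  have p1 := mul_nonneg hN hC
  have p2 := mul_nonneg hN hD
  have p3 := mul_nonneg (sq_nonneg N) hC
  have p4 := mul_nonneg (sq_nonneg N) hD
  have hKC : C ≤ K := by nlinarith
  have hKD : D ≤ K := by nlinarith
  have hKCD : C + D ≤ K := by nlinarith
  have hKNC : N * C ≤ K := by nlinarith
  have hKND : N * D ≤ K := by nlinarith
  have hKNNC : N * (N * C) ≤ K := by nlinarith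
  have hKNND : N * (N * D) ≤ K := by nlinarith
  have hK1 : 1 ≤ K := by rw [hKdef]; nlinarith [mul_nonneg (sq_nonneg (1 + N)) (add_nonneg hC hD)]
  have hK0 : 0 ≤ K := by linarith
  refine ⟨fun z ↦ mul_nonneg (f0 z) (g0 z), fun z ↦ mul_le_one₀ (f1 z) (g0 z) (g1 z),
    6 * K ^ 2, by positivity, fun z ↦ ?_⟩
  obtain ⟨a, b, ha0, haC, hb0, hbC, hR⟩ := hf z
  obtain ⟨a', b', ha0', haC', hb0', hbC', hR'⟩ := hg z
  have hbf := f0 z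
  have hbg := g0 z
  have hbf1 := f1 z
  have hbg1 := g1 z
  refine ⟨fun i ↦ g z * a i + f z * a' i, fun i j ↦ g z * b i j + f z * b' i j + a i * a' j,
    fun i ↦ ?_, fun i ↦ ?_, fun i j hij ↦ ?_, fun i j ↦ ?_, fun h hh ↦ ?_⟩
  · have := ha0 i; have := ha0' i; positivity
  · have h1 : g z * a i ≤ 1 * C := mul_le_mul hbg1 (haC i) (ha0 i) zero_le_one
    have h2 : f z * a' i ≤ 1 * D := mul_le_mul hbf1 (haC' i) (ha0' i) zero_le_one
    nlinarith
  · have := ha0 i; have := ha0' j; have := hb0 i j hij; have := hb0' i j hij; positivity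
  · have h1 : |g z * b i j| ≤ 1 * C := by
      rw [abs_mul, abs_of_nonneg hbg]; exact mul_le_mul hbg1 (hbC i j) (abs_nonneg _) zero_le_one
    have h2 : |f z * b' i j| ≤ 1 * D := by
      rw [abs_mul, abs_of_nonneg hbf]; exact mul_le_mul hbf1 (hbC' i j) (abs_nonneg _) zero_le_one
    have h3 : |a i * a' j| ≤ K * K := by
      rw [abs_mul, abs_of_nonneg (ha0 i), abs_of_nonneg (ha0' j)]
      exact mul_le_mul ((haC i).trans hKC) ((haC' j).trans hKD) (ha0' j) hK0
    have := abs_add_three (g z * b i j) (f z * b' i j) (a i * a' j)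
    nlinarith
  · have habs : ∀ x : ℝ, 0 ≤ x → x ≤ 1 → |x| ≤ 1 := fun x h0 h1 ↦ by rwa [abs_of_nonneg h0]
    have hr := norm_nonneg h
    have := abs_product_expansion_le (f := f z) (g := g z) (F := f (z + h)) (G := g (z + h))
      (A := ∑ i, a i * h i) (A' := ∑ i, a' i * h i) (B := ∑ i, ∑ j, b i j * (h i * h j))
      (B' := ∑ i, ∑ j, b' i j * (h i * h j)) hr hh hK1 (habs _ (f0 _) (f1 _))
      (habs _ (g0 _) (g1 _))
      ((abs_sum_mul_le (fun i ↦ (abs_of_nonneg (ha0 i)).le.trans (haC i)) h).trans (by gcongr))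
      ((abs_sum_sum_mul_le hbC h).trans (by gcongr))
      ((abs_sum_mul_le (fun i ↦ (abs_of_nonneg (ha0' i)).le.trans (haC' i)) h).trans (by gcongr))
      ((abs_sum_sum_mul_le hbC' h).trans (by gcongr))
      ((hR h hh).trans (by gcongr)) ((hR' h hh).trans (by gcongr))
    convert! this using 4
    · simp only [add_mul, Finset.sum_add_distrib, Finset.mul_sum, mul_assoc]
    · rw [Finset.sum_mul_sum]
      simp only [add_mul, Finset.sum_add_distrib, Finset.mul_sum, mul_assoc]
      congr 1
      refine Finset.sum_congr rfl fun i _ ↦ Finset.sum_congr rfl fun j _ ↦ by ring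

lemma HasMonotoneExpansion.prod {κ : Type*} {f : κ → (ι → ℝ) → ℝ} (s : Finset κ)
    (hf : ∀ k ∈ s, HasMonotoneExpansion (f k)) :
    HasMonotoneExpansion (fun z ↦ ∏ k ∈ s, f k z) := by
  classical
  induction s using Finset.induction_on with
  | empty => simpa using HasMonotoneExpansion.one
  | insert k s hk ih =>
    simp only [Finset.prod_insert hk]
    exact (hf k (by simp)).mul (ih fun j hj ↦ hf j (by simp [hj]))

lemma hasMonotoneExpansion_smoothTransition (k : ι) {m : ℝ} (hm : 0 ≤ m) (x₀ : ℝ) :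
    HasMonotoneExpansion (fun z : ι → ℝ ↦ Real.smoothTransition (m * (z k - x₀))) := by
  classical
  refine ⟨fun z ↦ Real.smoothTransition.nonneg _, fun z ↦ Real.smoothTransition.le_one _, ?_⟩
  obtain ⟨C, hC, H⟩ := smoothTransition_expansion
  have hCm : 0 ≤ C * m := by positivity
  have hCm2 : 0 ≤ C * m ^ 2 := by positivity
  have hCm3 : 0 ≤ C * m ^ 3 := by positivity
  refine ⟨C * m + C * m ^ 2 + C * m ^ 3, by positivity, fun z ↦ ?_⟩
  obtain ⟨a, b, ha0, ha, hb, hR⟩ := H (m * (z k - x₀))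
  refine ⟨Pi.single k (a * m), Pi.single k (Pi.single k (b * m ^ 2)), fun i ↦ ?_, fun i ↦ ?_,
    fun i j hij ↦ ?_, fun i j ↦ ?_, fun h hh ↦ ?_⟩
  · by_cases hi : i = k
    · subst hi; simp; positivity
    · simp [hi]
  · by_cases hi : i = k
    · subst hi
      have : a * m ≤ C * m := by gcongr
      simp; linarith
    · simp [hi]; positivity
  · by_cases hi : i = k
    · subst hi; simp [hij.symm]
    · simp [hi]
  · by_cases hi : i = k
    · subst hi
      by_cases hj : j = i
      · subst hj
        simp only [Pi.single_eq_same, abs_mul, abs_of_nonneg (sq_nonneg m)]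
        have : |b| * m ^ 2 ≤ C * m ^ 2 := by gcongr
        linarith
      · simp [hj]; positivity
    · simp [hi]; positivity
  · have h1 := hR (m * h k)
    have e1 : ∑ i, (Pi.single k (a * m) : ι → ℝ) i * h i = a * (m * h k) := by
      rw [Finset.sum_eq_single k (fun i _ hi ↦ by simp [hi]) (by simp)]
      simp; ring
    have e2 : ∑ i, ∑ j, (Pi.single k (Pi.single k (b * m ^ 2)) : ι → ι → ℝ) i j * (h i * h j)
        = b * (m * h k) ^ 2 := by
      rw [Finset.sum_eq_single k (fun i _ hi ↦ by simp [hi]) (by simp),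
        Finset.sum_eq_single k (fun i _ hi ↦ by simp [hi]) (by simp)]
      simp; ring
    rw [e1, e2]
    have e3 : m * ((z + h) k - x₀) = m * (z k - x₀) + m * h k := by simp; ring
    beta_reduce
    rw [e3]
    refine h1.trans ?_
    have h2 : |h k| ≤ ‖h‖ := norm_le_pi_norm h k
    calc C * |m * h k| ^ 3 = C * m ^ 3 * |h k| ^ 3 := by
          rw [abs_mul, abs_of_nonneg hm]; ring
      _ ≤ (C * m + C * m ^ 2 + C * m ^ 3) * ‖h‖ ^ 3 := by gcongr; linarith

/-- For ‖h‖ ≥ 1 the values of `f` and the first and second order terms are all O(‖h‖³), so the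
restriction to small `h` can be dropped, which integration over Gaussian increments needs. -/
lemma HasMonotoneExpansion.global {f : (ι → ℝ) → ℝ} (hf : HasMonotoneExpansion f) :
    ∃ C, 0 ≤ C ∧ ∀ z, ∃ (a : ι → ℝ) (b : ι → ι → ℝ), (∀ i j, i ≠ j → 0 ≤ b i j) ∧
      ∀ h : ι → ℝ,
        |f (z + h) - f z - ∑ i, a i * h i - ∑ i, ∑ j, b i j * (h i * h j)| ≤ C * ‖h‖ ^ 3 := by
  obtain ⟨f0, f1, C, hC, hf⟩ := hf
  set N : ℝ := (Fintype.card ι : ℝ)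
  have hN : 0 ≤ N := Nat.cast_nonneg _
  have hNC : 0 ≤ N * C := by positivity
  have hNNC : 0 ≤ N * (N * C) := by positivity
  refine ⟨C + (1 + N * C + N * (N * C)), by positivity, fun z ↦ ?_⟩
  obtain ⟨a, b, ha0, haC, hb0, hbC, hR⟩ := hf z
  refine ⟨a, b, hb0, fun h ↦ ?_⟩
  rcases le_total ‖h‖ 1 with hh | hh
  · refine (hR h hh).trans ?_
    gcongr
    linarith
  · have h1 := abs_sum_mul_le (fun i ↦ (abs_of_nonneg (ha0 i)).le.trans (haC i)) h
    have h2 := abs_sum_sum_mul_le hbC h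
    have h3 : ‖h‖ ≤ ‖h‖ ^ 3 := le_self_pow₀ hh (by norm_num)
    have h4 : ‖h‖ ^ 2 ≤ ‖h‖ ^ 3 := pow_le_pow_right₀ hh (by norm_num)
    have h5 : 1 ≤ ‖h‖ ^ 3 := one_le_pow₀ hh
    have h6 : N * C * ‖h‖ ≤ N * C * ‖h‖ ^ 3 := by gcongr
    have h7 : N * (N * C) * ‖h‖ ^ 2 ≤ N * (N * C) * ‖h‖ ^ 3 := by gcongr
    have h8 : 0 ≤ C * ‖h‖ ^ 3 := by positivity
    have := f0 (z + h)
    have := f1 (z + h)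
    have := f0 z
    have := f1 z
    rw [abs_le] at h1 h2 ⊢
    constructor <;> nlinarith

end Expansion

/-! ### Slepian's inequality by a Lindeberg replacement argument -/

section Slepian

variable {ι : Type*} [Fintype ι]

lemma integrable_norm_cube {μ : Measure (ι → ℝ)} [IsGaussian μ] :
    Integrable (fun x ↦ ‖x‖ ^ 3) μ := by
  have := (IsGaussian.memLp_id μ 3 (by simp)).integrable_norm_pow (by norm_num)
  simpa using this

lemma integrable_coord {μ : Measure (ι → ℝ)} [IsGaussian μ] (i : ι) :
    Integrable (fun x ↦ x i) μ :=
  (ContinuousLinearMap.proj (R := ℝ) (φ := fun _ : ι ↦ ℝ) i).integrable_comp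
    (IsGaussian.integrable_id (μ := μ))

lemma memLp_two_coord {μ : Measure (ι → ℝ)} [IsGaussian μ] (i : ι) :
    MemLp (fun x ↦ x i) 2 μ :=
  (ContinuousLinearMap.proj (R := ℝ) (φ := fun _ : ι ↦ ℝ) i).comp_memLp'
    (IsGaussian.memLp_two_id (μ := μ))

lemma integrable_coord_mul {μ : Measure (ι → ℝ)} [IsGaussian μ] (i j : ι) :
    Integrable (fun x ↦ x i * x j) μ :=
  (memLp_two_coord i).integrable_mul (memLp_two_coord j)

/-- Rescaled copies of a centered Gaussian measure form a convolution semigroup. -/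
lemma map_smul_conv_map_smul {μ : Measure (ι → ℝ)} [IsGaussian μ] (hμ : ∀ i, ∫ x, x i ∂μ = 0)
    {a b c : ℝ} (h : a ^ 2 + b ^ 2 = c ^ 2) :
    (μ.map (fun x ↦ a • x)) ∗ (μ.map (fun x ↦ b • x)) = μ.map (fun x ↦ c • x) := by
  have hμ0 : μ[id] = 0 := by
    ext i
    have := (ContinuousLinearMap.proj (R := ℝ) (φ := fun _ : ι ↦ ℝ) i).integral_comp_comm
      (IsGaussian.integrable_id (μ := μ))
    simp only [ContinuousLinearMap.proj_apply, id_eq] at this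
    simp only [id_eq, Pi.zero_apply]
    rw [← this, hμ]
  have key : ∀ (a : ℝ) (L : StrongDual ℝ (ι → ℝ)), charFunDual (μ.map (fun x ↦ a • x)) L
      = Complex.exp (-(a ^ 2 * Var[L; μ] : ℝ) / 2) := by
    intro a L
    have e1 : (fun x : ι → ℝ ↦ a • x) = ⇑(a • ContinuousLinearMap.id ℝ (ι → ℝ)) := by ext; simp
    rw [e1, charFunDual_map, IsGaussian.charFunDual_eq_of_integral_eq_zero hμ0]
    have e2 : ⇑(L.comp (a • ContinuousLinearMap.id ℝ (ι → ℝ))) = fun x ↦ a * L x := by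
      ext x; simp
    rw [e2, variance_const_mul]
  have ha : ∀ a : ℝ, IsProbabilityMeasure (μ.map (fun x ↦ a • x)) := fun a ↦
    Measure.isProbabilityMeasure_map (by fun_prop)
  have := ha a
  have := ha b
  have := ha c
  apply Measure.ext_of_charFunDual
  ext L
  rw [charFunDual_conv, key, key, key, ← Complex.exp_add, ← h]
  congr 1
  push_cast
  ring

lemma integral_expansion {μ : Measure (ι → ℝ)} [IsGaussian μ] (hμ : ∀ i, ∫ x, x i ∂μ = 0)
    (c : ℝ) (a : ι → ℝ) (b : ι → ι → ℝ) (s : ℝ) :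
    Integrable (fun x ↦ c + ∑ i, a i * (s • x) i + ∑ i, ∑ j, b i j * ((s • x) i * (s • x) j)) μ ∧
    ∫ x, (c + ∑ i, a i * (s • x) i + ∑ i, ∑ j, b i j * ((s • x) i * (s • x) j)) ∂μ
      = c + s ^ 2 * ∑ i, ∑ j, b i j * ∫ x, x i * x j ∂μ := by
  have i1 : ∀ i, Integrable (fun x : ι → ℝ ↦ a i * (s • x) i) μ := fun i ↦ by
    simpa [mul_assoc] using (integrable_coord (μ := μ) i).const_mul (a i * s)
  have i2 : ∀ i j, Integrable (fun x : ι → ℝ ↦ b i j * ((s • x) i * (s • x) j)) μ := fun i j ↦ by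
    refine ((integrable_coord_mul (μ := μ) i j).const_mul (b i j * s ^ 2)).congr
      (Eventually.of_forall fun x ↦ ?_)
    simp; ring
  have i3 := integrable_finsetSum Finset.univ fun i _ ↦ i1 i
  have i4 : ∀ i, Integrable (fun x ↦ ∑ j, b i j * ((s • x) i * (s • x) j)) μ := fun i ↦
    integrable_finsetSum Finset.univ fun j _ ↦ i2 i j
  have i5 := integrable_finsetSum Finset.univ fun i _ ↦ i4 i
  have i6 : Integrable (fun x ↦ c + ∑ i, a i * (s • x) i) μ := (integrable_const c).add i3
  refine ⟨i6.add i5, ?_⟩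
  rw [integral_add i6 i5, integral_add (integrable_const c) i3, integral_finsetSum _ fun i _ ↦ i1 i,
    integral_finsetSum _ fun i _ ↦ i4 i]
  have e1 : ∀ i, ∫ x : ι → ℝ, a i * (s • x) i ∂μ = 0 := fun i ↦ by
    simp [integral_const_mul, hμ]
  have e2 : ∀ i j, ∫ x : ι → ℝ, b i j * ((s • x) i * (s • x) j) ∂μ
      = s ^ 2 * (b i j * ∫ x, x i * x j ∂μ) := fun i j ↦ by
    rw [← integral_const_mul, ← integral_const_mul]
    congr 1; ext x; simp; ring
  have e3 : ∀ i, ∫ x, ∑ j, b i j * ((s • x) i * (s • x) j) ∂μ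
      = s ^ 2 * ∑ j, b i j * ∫ x, x i * x j ∂μ := fun i ↦ by
    rw [integral_finsetSum _ fun j _ ↦ i2 i j, Finset.mul_sum]
    exact Finset.sum_congr rfl fun j _ ↦ e2 i j
  rw [Finset.sum_congr rfl fun i _ ↦ e1 i, Finset.sum_congr rfl fun i _ ↦ e3 i, ← Finset.mul_sum]
  simp

lemma integrable_of_mem_unitInterval {E : Type*} [MeasurableSpace E] {μ : Measure E}
    [IsProbabilityMeasure μ] {f : E → ℝ} (hm : Measurable f) (f0 : ∀ z, 0 ≤ f z)
    (f1 : ∀ z, f z ≤ 1) : Integrable f μ :=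
  Integrable.of_bound hm.aestronglyMeasurable 1
    (Eventually.of_forall fun z ↦ by rw [Real.norm_of_nonneg (f0 z)]; exact f1 z)

variable {μ ν : Measure (ι → ℝ)} [IsGaussian μ] [IsGaussian ν]

/-- Linear terms vanish by centering, diagonal quadratic terms agree, and off-diagonal ones favour μ
because their coefficients are nonnegative. The remainder costs s³ times third absolute moments,
uniformly in `z`. -/
lemma integral_sub_integral_ge (hμ : ∀ i, ∫ x, x i ∂μ = 0) (hν : ∀ i, ∫ x, x i ∂ν = 0)
    (hdiag : ∀ i, ∫ x, x i * x i ∂μ = ∫ x, x i * x i ∂ν)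
    (hcov : ∀ i j, ∫ x, x i * x j ∂ν ≤ ∫ x, x i * x j ∂μ) {f : (ι → ℝ) → ℝ}
    (hfm : Measurable f) (hf : HasMonotoneExpansion f) :
    ∃ C, 0 ≤ C ∧ ∀ z s, 0 ≤ s →
      ∫ y, f (z + s • y) ∂ν - C * s ^ 3 ≤ ∫ x, f (z + s • x) ∂μ := by
  obtain ⟨C, hC, H⟩ := hf.global
  have m3μ : 0 ≤ ∫ x, ‖x‖ ^ 3 ∂μ := integral_nonneg fun x ↦ by positivity
  have m3ν : 0 ≤ ∫ x, ‖x‖ ^ 3 ∂ν := integral_nonneg fun x ↦ by positivity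
  refine ⟨C * ∫ x, ‖x‖ ^ 3 ∂μ + C * ∫ x, ‖x‖ ^ 3 ∂ν, by positivity, fun z s hs ↦ ?_⟩
  obtain ⟨a, b, hb, hR⟩ := H z
  obtain ⟨iμ, eμ⟩ := integral_expansion hμ (f z) a b s
  obtain ⟨iν, eν⟩ := integral_expansion hν (f z) a b s
  have rμ : Integrable (fun x ↦ C * s ^ 3 * ‖x‖ ^ 3) μ := integrable_norm_cube.const_mul _
  have rν : Integrable (fun x ↦ C * s ^ 3 * ‖x‖ ^ 3) ν := integrable_norm_cube.const_mul _
  have hn : ∀ x : ι → ℝ, C * ‖s • x‖ ^ 3 = C * s ^ 3 * ‖x‖ ^ 3 := fun x ↦ by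
    rw [norm_smul, Real.norm_of_nonneg hs]; ring
  have fm : Measurable fun x : ι → ℝ ↦ f (z + s • x) := hfm.comp (by fun_prop)
  have lower : f z + s ^ 2 * ∑ i, ∑ j, b i j * ∫ x, x i * x j ∂μ - C * s ^ 3 * ∫ x, ‖x‖ ^ 3 ∂μ
      ≤ ∫ x, f (z + s • x) ∂μ := by
    rw [← eμ, ← integral_const_mul, ← integral_sub iμ rμ]
    refine integral_mono (iμ.sub rμ)
      (integrable_of_mem_unitInterval fm (fun _ ↦ hf.1 _) fun _ ↦ hf.2.1 _) fun x ↦ ?_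
    have := (abs_le.1 (hR (s • x))).1
    rw [hn] at this
    simp only
    linarith
  have upper : ∫ x, f (z + s • x) ∂ν
      ≤ f z + s ^ 2 * ∑ i, ∑ j, b i j * ∫ x, x i * x j ∂ν + C * s ^ 3 * ∫ x, ‖x‖ ^ 3 ∂ν := by
    rw [← eν, ← integral_const_mul, ← integral_add iν rν]
    refine integral_mono
      (integrable_of_mem_unitInterval fm (fun _ ↦ hf.1 _) fun _ ↦ hf.2.1 _) (iν.add rν) fun x ↦ ?_
    have := (abs_le.1 (hR (s • x))).2
    rw [hn] at this
    simp only
    linarith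
  have comp : ∑ i, ∑ j, b i j * ∫ x, x i * x j ∂ν ≤ ∑ i, ∑ j, b i j * ∫ x, x i * x j ∂μ := by
    refine Finset.sum_le_sum fun i _ ↦ Finset.sum_le_sum fun j _ ↦ ?_
    rcases eq_or_ne i j with rfl | hij
    · rw [hdiag]
    · exact mul_le_mul_of_nonneg_left (hcov i j) (hb i j hij)
  nlinarith [mul_le_mul_of_nonneg_left comp (sq_nonneg s)]

/-- **Slepian's inequality**, for products of smooth increasing functions of the coordinates:
the one with the larger covariances has the larger expectation. The proof replaces, one at a time,
`n` independent summands of covariance `Cov(ν) / n` by summands of covariance `Cov(μ) / n`. -/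
lemma integral_le_integral_of_covariance_le (hμ : ∀ i, ∫ x, x i ∂μ = 0)
    (hν : ∀ i, ∫ x, x i ∂ν = 0)
    (hdiag : ∀ i, ∫ x, x i * x i ∂μ = ∫ x, x i * x i ∂ν)
    (hcov : ∀ i j, ∫ x, x i * x j ∂ν ≤ ∫ x, x i * x j ∂μ) {f : (ι → ℝ) → ℝ}
    (hfm : Measurable f) (hf : HasMonotoneExpansion f) :
    ∫ x, f x ∂ν ≤ ∫ x, f x ∂μ := by
  obtain ⟨C, hC, H⟩ := integral_sub_integral_ge hμ hν hdiag hcov hfm hf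
  have pμ : ∀ a : ℝ, IsProbabilityMeasure (μ.map (fun x ↦ a • x)) := fun a ↦
    Measure.isProbabilityMeasure_map (by fun_prop)
  have pν : ∀ a : ℝ, IsProbabilityMeasure (ν.map (fun x ↦ a • x)) := fun a ↦
    Measure.isProbabilityMeasure_map (by fun_prop)
  have swap : ∀ (ρ : Measure (ι → ℝ)) [IsProbabilityMeasure ρ] (s : ℝ), 0 ≤ s →
      ∫ x, f x ∂(ρ ∗ ν.map (fun x ↦ s • x)) - C * s ^ 3
        ≤ ∫ x, f x ∂(ρ ∗ μ.map (fun x ↦ s • x)) := by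
    intro ρ _ s hs
    have conv_eq : ∀ (κ : Measure (ι → ℝ)) [IsProbabilityMeasure κ],
        Integrable (fun z ↦ ∫ y, f (z + s • y) ∂κ) ρ ∧
        ∫ x, f x ∂(ρ ∗ κ.map (fun x ↦ s • x)) = ∫ z, ∫ y, f (z + s • y) ∂κ ∂ρ := by
      intro κ _
      have : IsProbabilityMeasure (κ.map (fun x ↦ s • x)) :=
        Measure.isProbabilityMeasure_map (by fun_prop)
      constructor
      · refine integrable_of_mem_unitInterval ?_ (fun z ↦ integral_nonneg fun _ ↦ hf.1 _)
          fun z ↦ ?_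
        · have : StronglyMeasurable (Function.uncurry fun z y : ι → ℝ ↦ f (z + s • y)) :=
            (hfm.comp (by fun_prop)).stronglyMeasurable
          exact this.integral_prod_right.measurable
        · calc ∫ y, f (z + s • y) ∂κ ≤ ∫ _y, (1 : ℝ) ∂κ :=
                integral_mono (integrable_of_mem_unitInterval (hfm.comp (by fun_prop))
                  (fun _ ↦ hf.1 _) fun _ ↦ hf.2.1 _) (integrable_const _) fun _ ↦ hf.2.1 _
            _ = 1 := by simp
      · rw [integral_conv (integrable_of_mem_unitInterval hfm hf.1 hf.2.1)]
        congr 1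
        ext z
        have hz : Measurable fun y ↦ f (z + y) := hfm.comp (by fun_prop)
        rw [integral_map (by fun_prop) hz.aestronglyMeasurable]
    rw [(conv_eq ν).2, (conv_eq μ).2]
    calc ∫ z, ∫ y, f (z + s • y) ∂ν ∂ρ - C * s ^ 3
        = ∫ z, (∫ y, f (z + s • y) ∂ν - C * s ^ 3) ∂ρ := by
          rw [integral_sub (conv_eq ν).1 (integrable_const _)]; simp
      _ ≤ ∫ z, ∫ y, f (z + s • y) ∂μ ∂ρ :=
          integral_mono ((conv_eq ν).1.sub (integrable_const _)) (conv_eq μ).1 fun z ↦ H z s hs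
  have step : ∀ n : ℕ, 0 < n → ∫ x, f x ∂ν - C * (√n)⁻¹ ≤ ∫ x, f x ∂μ := by
    intro n hn
    have hn' : (0 : ℝ) < n := by exact_mod_cast hn
    set s : ℝ := (√n)⁻¹ with hs
    have hs0 : 0 ≤ s := by positivity
    have hs2 : s ^ 2 = (n : ℝ)⁻¹ := by rw [hs, inv_pow, Real.sq_sqrt hn'.le]
    -- Expectation after `k` of the `n` summands have been replaced: the semigroup property merges
    -- the μ-summands into one scaled copy of μ, and the others into one of ν.
    set G : ℕ → ℝ := fun k ↦
      ∫ x, f x ∂(μ.map (fun x ↦ √(k / n) • x) ∗ ν.map (fun x ↦ √((n - k) / n) • x)) with hG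
    have ind : ∀ k : ℕ, k ≤ n → G 0 - k * (C * s ^ 3) ≤ G k := by
      intro k
      induction k with
      | zero => simp
      | succ k ih =>
        intro hk
        have hk' : (k : ℝ) + 1 ≤ n := by exact_mod_cast hk
        refine le_trans ?_ (b := G k - C * s ^ 3) ?_
        · have := ih (by omega)
          push_cast
          linarith
        -- The part common to `G k` and `G (k + 1)`, which differ only in the law of one summand of
        -- scale s = 1 / √n.
        · set ρ := μ.map (fun x ↦ √(k / n) • x) ∗ ν.map (fun x ↦ √((n - (k + 1)) / n) • x)
          have h1 : G k = ∫ x, f x ∂(ρ ∗ ν.map (fun x ↦ s • x)) := by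
            rw [hG, Measure.conv_assoc, map_smul_conv_map_smul hν (c := √((n - k) / n))]
            rw [hs2, Real.sq_sqrt (div_nonneg (by linarith) hn'.le),
              Real.sq_sqrt (div_nonneg (by linarith) hn'.le)]
            field_simp
            ring
          have h2 : G (k + 1) = ∫ x, f x ∂(ρ ∗ μ.map (fun x ↦ s • x)) := by
            rw [Measure.conv_assoc, Measure.conv_comm (ν.map _), ← Measure.conv_assoc,
              map_smul_conv_map_smul hμ (c := √((k + 1) / n))]
            · simp [hG]
            · rw [hs2, Real.sq_sqrt (by positivity), Real.sq_sqrt (by positivity)]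
              field_simp
          rw [h1, h2]
          exact swap ρ s hs0
    have h0 : G 0 = ∫ x, f x ∂ν := by
      simp only [hG, CharP.cast_eq_zero, zero_div, Real.sqrt_zero, zero_smul, sub_zero,
        div_self hn'.ne', Real.sqrt_one, one_smul, Measure.map_id', Measure.map_const,
        measure_univ, Measure.dirac_zero_conv]
    have hnn : G n = ∫ x, f x ∂μ := by
      simp only [hG, zero_div, Real.sqrt_zero, zero_smul, sub_self,
        div_self hn'.ne', Real.sqrt_one, one_smul, Measure.map_id', Measure.map_const,
        measure_univ, Measure.conv_dirac_zero]
    have := ind n le_rfl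
    rw [h0, hnn] at this
    -- Each of the `n` replacements costs C s³ with s² = 1 / n, so the total error C s vanishes as n
    -- → ∞.
    have e : (n : ℝ) * (C * s ^ 3) = C * s := by
      have : (n : ℝ) * s ^ 2 = 1 := by rw [hs2]; field_simp
      linear_combination C * s * this
    linarith
  have lim : Tendsto (fun n : ℕ ↦ ∫ x, f x ∂ν - C * (√n)⁻¹) atTop (𝓝 (∫ x, f x ∂ν - C * 0)) := by
    refine tendsto_const_nhds.sub (Tendsto.const_mul _ ?_)
    exact tendsto_inv_atTop_zero.comp
      (Real.tendsto_sqrt_atTop.comp tendsto_natCast_atTop_atTop)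
  rw [mul_zero, sub_zero] at lim
  exact le_of_tendsto lim (eventually_atTop.2 ⟨1, fun n hn ↦ step n hn⟩)

/-- **Slepian's inequality**, in a form with some slack `ε`: positive association increases the
probability that all coordinates are large. -/
theorem slepian (hμ : ∀ i, ∫ x, x i ∂μ = 0) (hν : ∀ i, ∫ x, x i ∂ν = 0)
    (hdiag : ∀ i, ∫ x, x i * x i ∂μ = ∫ x, x i * x i ∂ν)
    (hcov : ∀ i j, ∫ x, x i * x j ∂ν ≤ ∫ x, x i * x j ∂μ) (a : ι → ℝ) {ε : ℝ} (hε : 0 < ε) :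
    ν.real {x | ∀ i, a i + ε < x i} ≤ μ.real {x | ∀ i, a i < x i} := by
  -- A smooth product lying between the indicators of the orthants at `a + ε` and at `a`; the slack
  -- ε is the width of the smoothing.
  set f : (ι → ℝ) → ℝ := fun z ↦ ∏ i, Real.smoothTransition (ε⁻¹ * (z i - a i))
  have hf : HasMonotoneExpansion f := HasMonotoneExpansion.prod Finset.univ fun i _ ↦
    hasMonotoneExpansion_smoothTransition i (inv_nonneg.2 hε.le) (a i)
  have hfm : Measurable f := by
    refine Continuous.measurable (continuous_finsetProd _ fun i _ ↦ ?_)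
    exact Real.smoothTransition.continuous.comp (by fun_prop)
  have hmeas : ∀ b : ι → ℝ, MeasurableSet {x : ι → ℝ | ∀ i, b i < x i} := fun b ↦ by
    rw [Set.ofPred_forall]
    exact MeasurableSet.iInter fun i ↦ measurableSet_lt measurable_const (measurable_pi_apply i)
  have key := integral_le_integral_of_covariance_le hμ hν hdiag hcov hfm hf
  calc ν.real {x | ∀ i, a i + ε < x i}
      = ∫ x, {x : ι → ℝ | ∀ i, a i + ε < x i}.indicator 1 x ∂ν := by
        rw [integral_indicator_one (hmeas _)]
    _ ≤ ∫ x, f x ∂ν := by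
        refine integral_mono ((integrable_const (1 : ℝ)).indicator (hmeas _))
          (integrable_of_mem_unitInterval hfm hf.1 hf.2.1) fun x ↦ ?_
        refine Set.indicator_apply_le' (fun hx ↦ ?_) fun _ ↦ hf.1 x
        have h1 : f x = 1 := Finset.prod_eq_one fun i _ ↦ by
          refine Real.smoothTransition.one_of_one_le ?_
          rw [inv_mul_eq_div, one_le_div hε]
          linarith [hx i]
        simp [h1]
    _ ≤ ∫ x, f x ∂μ := key
    _ ≤ ∫ x, {x : ι → ℝ | ∀ i, a i < x i}.indicator 1 x ∂μ := by
        refine integral_mono (integrable_of_mem_unitInterval hfm hf.1 hf.2.1)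
          ((integrable_const (1 : ℝ)).indicator (hmeas _)) fun x ↦ ?_
        by_cases hx : ∀ i, a i < x i
        · rw [Set.indicator_of_mem (by exact hx)]
          exact hf.2.1 x
        · rw [Set.indicator_of_notMem (by exact hx)]
          push Not at hx
          obtain ⟨i, hi⟩ := hx
          refine (Finset.prod_eq_zero (Finset.mem_univ i) ?_).le
          refine Real.smoothTransition.zero_of_nonpos ?_
          exact mul_nonpos_of_nonneg_of_nonpos (inv_nonneg.2 hε.le) (by linarith)
    _ = μ.real {x | ∀ i, a i < x i} := by rw [integral_indicator_one (hmeas _)]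

end Slepian

/-! ### Gaussian tails and densities -/

section GaussianTail

lemma setIntegral_Ioi_eq_shift (f : ℝ → ℝ) (a : ℝ) :
    ∫ x in Set.Ioi a, f x = ∫ w in Set.Ioi 0, f (w + a) := by
  rw [← (measurePreserving_add_right volume a).setIntegral_preimage_emb
    (measurableEmbedding_addRight a) f (Set.Ioi a)]
  simp

lemma gaussianReal_real_Ioi (m : ℝ) {v : ℝ≥0} (hv : v ≠ 0) (a : ℝ) :
    (gaussianReal m v).real (Set.Ioi a) = ∫ w in Set.Ioi 0, gaussianPDFReal m v (w + a) := by
  rw [measureReal_def, gaussianReal_apply_eq_integral m hv, ENNReal.toReal_ofReal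
    (setIntegral_nonneg measurableSet_Ioi fun x _ ↦ gaussianPDFReal_nonneg m v x),
    setIntegral_Ioi_eq_shift]

lemma gaussianReal_real_Ioi_eq_gaussianTail (m : ℝ) {v : ℝ≥0} (hv : v ≠ 0) (a : ℝ) :
    (gaussianReal m v).real (Set.Ioi a) = gaussianTail ((a - m) / √v) := by
  have hv0 : 0 < (v : ℝ) := NNReal.coe_pos.2 (pos_iff_ne_zero.2 hv)
  have h1 : (gaussianReal 0 1).map (fun x ↦ √v * x) = gaussianReal 0 v := by
    rw [gaussianReal_map_const_mul]
    congr 1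
    · simp
    · ext; simp
  have h2 : gaussianReal m v = (gaussianReal 0 1).map (fun x ↦ √v * x + m) := by
    have := gaussianReal_map_add_const (μ := 0) (v := v) m
    rw [zero_add, ← h1, Measure.map_map (by fun_prop) (by fun_prop)] at this
    rw [← this]; rfl
  rw [h2, gaussianTail, map_measureReal_apply (by fun_prop) measurableSet_Ioi]
  congr 1
  ext x
  simp only [Set.mem_preimage, Set.mem_Ioi]
  rw [div_lt_iff₀ (Real.sqrt_pos.2 hv0), sub_lt_iff_lt_add, mul_comm]

lemma integrable_gaussianPDFReal_mul {m : ℝ} {v : ℝ≥0} (hv : v ≠ 0) {f : ℝ → ℝ}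
    (hf : Integrable f (gaussianReal m v)) :
    Integrable (fun x ↦ gaussianPDFReal m v x * f x) := by
  rw [gaussianReal_of_var_ne_zero m hv, integrable_withDensity_iff_integrable_smul'
    (measurable_gaussianPDF m v) (ae_of_all _ fun _ ↦ gaussianPDF_lt_top)] at hf
  simpa [toReal_gaussianPDF] using hf

lemma integrable_gaussianPDFReal_mul_self {m : ℝ} {v : ℝ≥0} (hv : v ≠ 0) :
    Integrable (fun x ↦ gaussianPDFReal m v x * x) :=
  integrable_gaussianPDFReal_mul hv ((memLp_id_gaussianReal 1).integrable (by simp))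

lemma integrable_gaussianPDFReal_mul_sq {m : ℝ} {v : ℝ≥0} (hv : v ≠ 0) :
    Integrable (fun x ↦ gaussianPDFReal m v x * x ^ 2) :=
  integrable_gaussianPDFReal_mul hv
    (by simpa using (memLp_id_gaussianReal (μ := m) (v := v) 2).integrable_sq)

lemma conv_real_Ioi (μ ν : Measure ℝ) [IsProbabilityMeasure μ] [IsProbabilityMeasure ν] (a : ℝ) :
    (μ ∗ ν).real (Set.Ioi a) = ∫ y, ν.real (Set.Ioi (a - y)) ∂μ := by
  rw [← integral_indicator_one measurableSet_Ioi,
    integral_conv (f := (Set.Ioi a).indicator 1)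
      ((integrable_const (1 : ℝ)).indicator measurableSet_Ioi)]
  congr 1
  ext y
  rw [← integral_indicator_one measurableSet_Ioi]
  congr 1
  ext z
  simp [Set.indicator_apply, sub_lt_iff_lt_add']

lemma measurable_real_Ioi (ν : Measure ℝ) [IsProbabilityMeasure ν] :
    Measurable fun y ↦ ν.real (Set.Ioi y) := by
  have : Antitone fun y ↦ ν.real (Set.Ioi y) := fun x y h ↦
    measureReal_mono (Set.Ioi_subset_Ioi h)
  exact this.measurable

end GaussianTail

/-! ### The survival function of Brownian motion with drift -/

section Survival

/-- The probability that a Brownian motion with drift `-c` started from `x > 0` stays positive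
on `[0, t]`, given by an explicit formula that makes sense for all real `x`. -/
noncomputable def survivalFun (c x : ℝ) (t : ℝ≥0) : ℝ :=
  (gaussianReal (-(c * t)) t).real (Set.Ioi (-x))
    - Real.exp (2 * c * x) * (gaussianReal (-(c * t)) t).real (Set.Ioi x)

/-- Odd symmetry up to a positive factor: nonnegativity for x ≥ 0 becomes nonpositivity for x ≤ 0,
which handles killing in the walk comparison. -/
lemma survivalFun_neg (c x : ℝ) (t : ℝ≥0) :
    survivalFun c (-x) t = -(Real.exp (-(2 * c * x)) * survivalFun c x t) := by
  have : Real.exp (-(2 * c * x)) * Real.exp (2 * c * x) = 1 := by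
    rw [← Real.exp_add]; simp
  simp only [survivalFun, neg_neg, mul_neg]
  linear_combination -(gaussianReal (-(c * t)) t).real (Set.Ioi x) * this

lemma survivalFun_le_one (c x : ℝ) (t : ℝ≥0) : survivalFun c x t ≤ 1 := by
  have h1 : (gaussianReal (-(c * t)) t).real (Set.Ioi (-x)) ≤ 1 := measureReal_le_one
  have h2 : 0 ≤ Real.exp (2 * c * x) * (gaussianReal (-(c * t)) t).real (Set.Ioi x) := by
    positivity
  rw [survivalFun]
  linarith

/-- Method of images: the integrand is the density of the end point w times 1 - exp(-2xw/t), the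
probability that the bridge from x to w stays positive. -/
lemma survivalFun_eq_integral (c x : ℝ) {t : ℝ≥0} (ht : t ≠ 0) :
    survivalFun c x t = ∫ w in Set.Ioi 0,
      gaussianPDFReal (-(c * t)) t (w - x) * (1 - Real.exp (-(2 * x * w / t))) := by
  have ht0 : (t : ℝ) ≠ 0 := by exact_mod_cast ht
  have i1 : Integrable fun w ↦ gaussianPDFReal (-(c * t)) t (w + -x) :=
    (integrable_gaussianPDFReal _ _).comp_add_right (-x)
  have i2 : Integrable fun w ↦ Real.exp (2 * c * x) * gaussianPDFReal (-(c * t)) t (w + x) :=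
    ((integrable_gaussianPDFReal _ _).comp_add_right x).const_mul _
  rw [survivalFun, gaussianReal_real_Ioi _ ht, gaussianReal_real_Ioi _ ht, ← integral_const_mul,
    ← integral_sub i1.integrableOn i2.integrableOn]
  congr 1
  ext w
  rw [mul_sub, mul_one, sub_eq_add_neg w x]
  congr 1
  simp only [gaussianPDFReal_def]
  rw [mul_left_comm, ← Real.exp_add, mul_assoc _ (Real.exp _) (Real.exp _), ← Real.exp_add]
  congr 2
  field_simp
  ring

lemma survivalFun_nonneg (c : ℝ) {x : ℝ} (hx : 0 ≤ x) (t : ℝ≥0) : 0 ≤ survivalFun c x t := by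
  rcases eq_or_ne t 0 with rfl | ht
  · rcases hx.eq_or_lt with rfl | hx
    · simp [survivalFun]
    · have : (Measure.dirac (0 : ℝ)).real (Set.Ioi x) = 0 := by
        simp [measureReal_def, hx.le]
      simp [survivalFun, this]
  · rw [survivalFun_eq_integral c x ht]
    refine setIntegral_nonneg measurableSet_Ioi fun w hw ↦
      mul_nonneg (gaussianPDFReal_nonneg _ _ _) ?_
    rw [sub_nonneg, Real.exp_le_one_iff, neg_nonpos]
    have : 0 < w := hw
    positivity

lemma survivalFun_nonpos (c : ℝ) {x : ℝ} (hx : x ≤ 0) (t : ℝ≥0) : survivalFun c x t ≤ 0 := by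
  have h := survivalFun_neg c (-x) t
  rw [neg_neg] at h
  rw [h, neg_nonpos]
  exact mul_nonneg (Real.exp_pos _).le (survivalFun_nonneg c (by linarith) t)

lemma integrable_exp_mul_bounded {m : ℝ} {v : ℝ≥0} (a : ℝ) {F : ℝ → ℝ} (hF : Measurable F)
    (hb : ∀ x, |F x| ≤ 1) : Integrable (fun y ↦ Real.exp (a * y) * F y) (gaussianReal m v) :=
  (integrable_exp_mul_gaussianReal a).mul_bdd (c := 1) hF.aestronglyMeasurable
    (ae_of_all _ hb)

lemma abs_measureReal_le_one {E : Type*} [MeasurableSpace E] (ν : Measure E)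
    [IsProbabilityMeasure ν] (s : Set E) : |ν.real s| ≤ 1 := by
  rw [abs_of_nonneg measureReal_nonneg]; exact measureReal_le_one

/-- Exponential tilting reflects a Gaussian measure with opposite drift. -/
lemma integral_exp_mul_gaussianReal (c : ℝ) (d : ℝ≥0) (F : ℝ → ℝ) :
    ∫ y, Real.exp (2 * c * y) * F y ∂gaussianReal (-(c * d)) d
      = ∫ y, F (-y) ∂gaussianReal (-(c * d)) d := by
  rcases eq_or_ne d 0 with rfl | hd
  · simp
  have hd0 : (d : ℝ) ≠ 0 := by exact_mod_cast hd
  rw [integral_gaussianReal_eq_integral_smul hd, integral_gaussianReal_eq_integral_smul hd,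
    ← integral_neg_eq_self]
  congr 1
  ext y
  simp only [smul_eq_mul, gaussianPDFReal_def]
  rw [← mul_assoc, mul_assoc (_⁻¹), ← Real.exp_add]
  congr 3
  field_simp
  ring

lemma survivalFun_integrable (c x : ℝ) (d t : ℝ≥0) :
    Integrable (fun y ↦ survivalFun c (x + y) t) (gaussianReal (-(c * d)) d) := by
  have hm := measurable_real_Ioi (gaussianReal (-(c * t)) t)
  refine Integrable.sub ?_ ?_
  · exact Integrable.of_bound
      (hm.comp (by fun_prop : Measurable fun y ↦ -(x + y))).aestronglyMeasurable
      1 (ae_of_all _ fun y ↦ abs_measureReal_le_one _ _)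
  · have := (integrable_exp_mul_bounded (m := -(c * d)) (v := d) (2 * c)
      (hm.comp (by fun_prop : Measurable fun y ↦ x + y))
      fun y ↦ abs_measureReal_le_one _ _).const_mul (Real.exp (2 * c * x))
    refine this.congr (ae_of_all _ fun y ↦ ?_)
    simp only [Function.comp_apply]
    rw [← mul_assoc, ← Real.exp_add]
    ring_nf

/-- The semigroup property of the survival function. -/
lemma integral_survivalFun (c x : ℝ) (d t : ℝ≥0) :
    ∫ y, survivalFun c (x + y) t ∂gaussianReal (-(c * d)) d = survivalFun c x (d + t) := by
  have hm := measurable_real_Ioi (gaussianReal (-(c * t)) t)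
  have hconv : gaussianReal (-(c * d)) d ∗ gaussianReal (-(c * t)) t
      = gaussianReal (-(c * (d + t : ℝ≥0))) (d + t) := by
    rw [gaussianReal_conv_gaussianReal]
    congr 1
    push_cast
    ring
  have i1 : Integrable (fun y ↦ (gaussianReal (-(c * t)) t).real (Set.Ioi (-(x + y))))
      (gaussianReal (-(c * d)) d) :=
    Integrable.of_bound (hm.comp (by fun_prop : Measurable fun y ↦ -(x + y))).aestronglyMeasurable
      1 (ae_of_all _ fun y ↦ abs_measureReal_le_one _ _)
  have e2 : ∀ y, Real.exp (2 * c * (x + y)) * (gaussianReal (-(c * t)) t).real (Set.Ioi (x + y))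
      = Real.exp (2 * c * x) *
        (Real.exp (2 * c * y) * (gaussianReal (-(c * t)) t).real (Set.Ioi (x + y))) := fun y ↦ by
    rw [← mul_assoc, ← Real.exp_add]; ring_nf
  have i2 : Integrable (fun y ↦ Real.exp (2 * c * (x + y)) *
      (gaussianReal (-(c * t)) t).real (Set.Ioi (x + y))) (gaussianReal (-(c * d)) d) := by
    simp only [e2]
    exact (integrable_exp_mul_bounded (m := -(c * d)) (v := d) (2 * c)
      (hm.comp (by fun_prop : Measurable fun y ↦ x + y))
      fun y ↦ abs_measureReal_le_one _ _).const_mul (Real.exp (2 * c * x))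
  simp only [survivalFun]
  rw [integral_sub i1 i2]
  simp only [e2]
  -- The tilt replaces x + y by x - y, so that the image term also becomes a convolution tail.
  rw [integral_const_mul, integral_exp_mul_gaussianReal, ← hconv, conv_real_Ioi, conv_real_Ioi]
  congr 1
  · congr 1; ext y; congr 2; ring

/-- The quadratic correction in the expansion of the survival function at `0`. -/
noncomputable def survivalErr (c : ℝ) (t : ℝ≥0) : ℝ :=
  ∫ w in Set.Ioi 0, gaussianPDFReal (-(c * t)) t w * (2 * w ^ 2 / t ^ 2 + 1 / (2 * t))

lemma survivalErr_nonneg (c : ℝ) (t : ℝ≥0) : 0 ≤ survivalErr c t :=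
  setIntegral_nonneg measurableSet_Ioi fun w _ ↦
    mul_nonneg (gaussianPDFReal_nonneg _ _ _) (by positivity)

lemma hasDerivAt_gaussianPDFReal (m : ℝ) (v : ℝ≥0) (x : ℝ) :
    HasDerivAt (gaussianPDFReal m v) (-((x - m) / v * gaussianPDFReal m v x)) x := by
  have h : HasDerivAt (fun y ↦ -(y - m) ^ 2 / (2 * v)) (-(2 * (x - m)) / (2 * v)) x := by
    have := ((((hasDerivAt_id x).sub_const m).pow 2).neg).div_const (2 * (v : ℝ))
    convert! this using 1
    simp
  have := (h.exp).const_mul (√(2 * Real.pi * v))⁻¹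
  rw [gaussianPDFReal_def]
  convert! this using 1
  rcases eq_or_ne (v : ℝ) 0 with hv | hv
  · simp [hv]
  · field_simp

lemma tendsto_gaussianPDFReal_atTop (m : ℝ) {v : ℝ≥0} (hv : v ≠ 0) :
    Tendsto (gaussianPDFReal m v) atTop (𝓝 0) := by
  have hv0 : 0 < (v : ℝ) := NNReal.coe_pos.2 (pos_iff_ne_zero.2 hv)
  rw [gaussianPDFReal_def, ← mul_zero (√(2 * Real.pi * v))⁻¹]
  refine Tendsto.const_mul _ (Real.tendsto_exp_atBot.comp ?_)
  have h1 : Tendsto (fun x : ℝ ↦ (x - m) ^ 2) atTop atTop :=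
    (tendsto_pow_atTop two_ne_zero).comp (tendsto_atTop_add_const_right _ (-m) tendsto_id)
  have h2 := tendsto_neg_atTop_atBot.comp (h1.atTop_div_const (r := 2 * (v : ℝ)) (by positivity))
  refine h2.congr fun x ↦ ?_
  simp [neg_div]

/-- Since p' = -((w + ct) / t) p, the function -2p has derivative (2w / t) p + 2cp. Integrating over
(0, ∞) leaves the boundary term 2p(0) and the tail term. -/
lemma integral_pdf_mul_eq_constK (c : ℝ) {t : ℝ≥0} (ht : t ≠ 0) :
    ∫ w in Set.Ioi 0, gaussianPDFReal (-(c * t)) t w * (2 * w / t) = constK c t := by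
  have ht0 : 0 < (t : ℝ) := NNReal.coe_pos.2 (pos_iff_ne_zero.2 ht)
  set p := gaussianPDFReal (-(c * t)) t with hp
  have ip : Integrable p := integrable_gaussianPDFReal _ _
  have ipw : Integrable fun w ↦ p w * w := integrable_gaussianPDFReal_mul_self ht
  have hd : ∀ w, HasDerivAt (fun w ↦ -2 * p w) (p w * (2 * w / t) + 2 * c * p w) w := fun w ↦ by
    convert! (hasDerivAt_gaussianPDFReal (-(c * t)) t w).const_mul (-2) using 1
    rw [← hp]
    field_simp
    ring
  have i1 : Integrable fun w ↦ p w * (2 * w / t) :=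
    (ipw.const_mul (2 / t)).congr (ae_of_all _ fun w ↦ by simp only; ring)
  have i2 : Integrable fun w ↦ 2 * c * p w := ip.const_mul _
  have lim : Tendsto (fun w ↦ -2 * p w) atTop (𝓝 0) := by
    simpa using (tendsto_gaussianPDFReal_atTop (-(c * t)) ht).const_mul (-2)
  have ftc := integral_Ioi_of_hasDerivAt_of_tendsto' (a := 0) (fun w _ ↦ hd w)
    (i1.add i2).integrableOn lim
  rw [integral_add i1.integrableOn i2.integrableOn, integral_const_mul] at ftc
  have tail : ∫ w in Set.Ioi 0, p w = gaussianTail (c * √t) := by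
    have h1 := gaussianReal_real_Ioi (-(c * t)) ht 0
    rw [gaussianReal_real_Ioi_eq_gaussianTail _ ht] at h1
    simp only [add_zero, zero_sub, neg_neg] at h1
    rw [hp, ← h1]
    congr 1
    rw [mul_div_assoc, Real.div_sqrt]
  have p0 : p 0 = gaussianPDFReal 0 1 (c * √t) * (1 / √t) := by
    simp only [hp, gaussianPDFReal_def]
    rw [Real.sqrt_mul (by positivity) (t : ℝ), mul_inv]
    have : -(0 - -(c * (t : ℝ))) ^ 2 / (2 * t) = -(c * √t - 0) ^ 2 / (2 * (1 : ℝ≥0)) := by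
      rw [sub_zero, mul_pow, Real.sq_sqrt ht0.le]
      push_cast
      field_simp
      ring
    rw [this]
    simp
    ring
  rw [tail, p0] at ftc
  rw [constK]
  linarith

/-- In the image formula, both p(w - x) and 1 - exp(-2xw/t) are bounded below to the order needed at
x = 0. The coefficient of x is the integral just identified with `constK`. -/
lemma survivalFun_ge {c : ℝ} (hc : 0 ≤ c) {x : ℝ} (hx : 0 ≤ x) {t : ℝ≥0} (ht : t ≠ 0) :
    constK c t * x - survivalErr c t * x ^ 2 ≤ survivalFun c x t := by
  have ht0 : 0 < (t : ℝ) := NNReal.coe_pos.2 (pos_iff_ne_zero.2 ht)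
  rw [survivalFun_eq_integral c x ht, ← integral_pdf_mul_eq_constK c ht, survivalErr,
    ← integral_mul_const, ← integral_mul_const]
  set p := gaussianPDFReal (-(c * t)) t with hp
  have ip : Integrable p := integrable_gaussianPDFReal _ _
  have ipw : Integrable fun w ↦ p w * w := integrable_gaussianPDFReal_mul_self ht
  have ipw2 : Integrable fun w ↦ p w * w ^ 2 := integrable_gaussianPDFReal_mul_sq ht
  have i1 : Integrable fun w ↦ p w * (2 * w / t) * x :=
    (ipw.const_mul (2 / t * x)).congr (ae_of_all _ fun w ↦ by simp only; ring)
  have i2 : Integrable fun w ↦ p w * (2 * w ^ 2 / t ^ 2 + 1 / (2 * t)) * x ^ 2 :=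
    ((ipw2.const_mul (2 / t ^ 2 * x ^ 2)).add (ip.const_mul (1 / (2 * t) * x ^ 2))).congr
      (ae_of_all _ fun w ↦ by simp only [Pi.add_apply]; ring)
  rw [← integral_sub i1.integrableOn i2.integrableOn]
  refine setIntegral_mono_on (i1.sub i2).integrableOn ?_ measurableSet_Ioi fun w hw ↦ ?_
  · have hpm : Integrable fun w ↦ p (w - x) := ip.comp_sub_right x
    refine Integrable.mono' (g := fun w ↦ p (w - x)) hpm.integrableOn ?_ ?_
    · refine (hpm.aestronglyMeasurable.mul ?_).restrict
      exact (by fun_prop : Continuous fun w ↦ 1 - Real.exp (-(2 * x * w / t))).aestronglyMeasurable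
    · refine (ae_restrict_iff' measurableSet_Ioi).2 (ae_of_all _ fun w hw ↦ ?_)
      have hw0 : 0 < w := hw
      have h1 : Real.exp (-(2 * x * w / t)) ≤ 1 := by
        rw [Real.exp_le_one_iff, neg_nonpos]; positivity
      have h2 := Real.exp_pos (-(2 * x * w / t))
      rw [Real.norm_eq_abs, abs_mul, abs_of_nonneg (gaussianPDFReal_nonneg _ _ _), abs_of_nonneg
        (by linarith)]
      exact mul_le_of_le_one_right (gaussianPDFReal_nonneg _ _ _) (by linarith)
  · have hw0 : 0 < w := hw
    set y := 2 * x * w / t with hy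
    have hy0 : 0 ≤ y := by positivity
    -- From exp y ≥ 1 + y + y²/2 and (1 + y + y²/2)(1 - y + y²/2) = 1 + y⁴/4 ≥ 1.
    have e1 : Real.exp (-y) ≤ 1 - y + y ^ 2 / 2 := by
      have h1 := Real.quadratic_le_exp_of_nonneg hy0
      rw [Real.exp_neg, inv_le_comm₀ (Real.exp_pos _) (by nlinarith [sq_nonneg (y - 1)])]
      refine le_trans ?_ h1
      rw [inv_le_iff_one_le_mul₀ (by nlinarith [sq_nonneg (y - 1)])]
      nlinarith [sq_nonneg (y ^ 2)]
    -- The density ratio is the exponential of (2x(w + ct) - x²) / (2t), whose first part is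
    -- nonnegative because c ≥ 0.
    have e2 : p w * (1 - x ^ 2 / (2 * t)) ≤ p (w - x) := by
      have : p (w - x) = p w * Real.exp ((2 * x * (w + c * t) - x ^ 2) / (2 * t)) := by
        simp only [hp, gaussianPDFReal_def]
        rw [mul_assoc _ (Real.exp _) (Real.exp _), ← Real.exp_add]
        congr 2
        field_simp
        ring
      rw [this]
      refine mul_le_mul_of_nonneg_left ?_ (gaussianPDFReal_nonneg _ _ _)
      have h1 := Real.add_one_le_exp ((2 * x * (w + c * t) - x ^ 2) / (2 * t))
      refine le_trans ?_ h1
      have : 0 ≤ 2 * x * (w + c * t) / (2 * t) := by positivity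
      rw [sub_div]
      linarith
    have e3 : Real.exp (-y) ≤ 1 := by rw [Real.exp_le_one_iff]; linarith
    have e4 := Real.exp_pos (-y)
    have hpw : 0 ≤ p w := gaussianPDFReal_nonneg _ _ _
    have hA : 0 ≤ x ^ 2 / (2 * (t : ℝ)) := by positivity
    calc p w * (2 * w / t) * x - p w * (2 * w ^ 2 / t ^ 2 + 1 / (2 * t)) * x ^ 2
        = p w * (y - y ^ 2 / 2 - x ^ 2 / (2 * t)) := by
          rw [hy]; field_simp; ring
      _ ≤ p w * ((1 - x ^ 2 / (2 * t)) * (1 - Real.exp (-y))) := by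
          refine mul_le_mul_of_nonneg_left ?_ hpw
          nlinarith
      _ = p w * (1 - x ^ 2 / (2 * t)) * (1 - Real.exp (-y)) := by ring
      _ ≤ p (w - x) * (1 - Real.exp (-y)) :=
          mul_le_mul_of_nonneg_right e2 (by linarith)

/-- The closed form is a difference of positive terms; positivity is read off the integral
representation. -/
lemma constK_pos (c : ℝ) {t : ℝ≥0} (ht : t ≠ 0) : 0 < constK c t := by
  have ht0 : 0 < (t : ℝ) := NNReal.coe_pos.2 (pos_iff_ne_zero.2 ht)
  have hpos : ∀ w ∈ Set.Ioi (0 : ℝ), 0 < gaussianPDFReal (-(c * t)) t w * (2 * w / t) :=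
    fun w hw ↦ by
      have hw0 : 0 < w := hw
      exact mul_pos (gaussianPDFReal_pos _ _ _ ht) (by positivity)
  have hint : Integrable fun w ↦ gaussianPDFReal (-(c * t)) t w * (2 * w / t) :=
    ((integrable_gaussianPDFReal_mul_self ht).const_mul (2 / t)).congr
      (ae_of_all _ fun w ↦ by simp only; ring)
  rw [← integral_pdf_mul_eq_constK c ht, setIntegral_pos_iff_support_of_nonneg_ae
    ((ae_restrict_iff' measurableSet_Ioi).2 (ae_of_all _ fun w hw ↦ (hpos w hw).le))
    hint.integrableOn, Set.inter_eq_right.2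
      (fun w hw ↦ Function.mem_support.2 (hpos w hw).ne')]
  simp

end Survival

/-! ### Gaussian random walks above a line -/

section Walk

lemma pi_real_succ {n : ℕ} (μ : Fin (n + 1) → Measure ℝ) [∀ i, IsProbabilityMeasure (μ i)]
    {B : Set (Fin (n + 1) → ℝ)} (hB : MeasurableSet B) :
    Integrable (fun y ↦ (Measure.pi fun j : Fin n ↦ μ j.succ).real
      {η | (Fin.cons y η : Fin (n + 1) → ℝ) ∈ B}) (μ 0) ∧
    (Measure.pi μ).real B = ∫ y, (Measure.pi fun j : Fin n ↦ μ j.succ).real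
      {η | (Fin.cons y η : Fin (n + 1) → ℝ) ∈ B} ∂μ 0 := by
  set e := (MeasurableEquiv.piFinSuccAbove (fun _ : Fin (n + 1) ↦ ℝ) 0).symm with he
  have hmp := (measurePreserving_piFinSuccAbove μ 0).symm
  simp only [Fin.succAbove_zero] at hmp
  have hcons : ∀ y η, e (y, η) = (Fin.cons y η : Fin (n + 1) → ℝ) := fun y η ↦ by
    simp [he, MeasurableEquiv.piFinSuccAbove, Fin.insertNthEquiv]
  have hpre : MeasurableSet (e ⁻¹' B) := e.measurable hB
  have hset : ∀ y, Prod.mk y ⁻¹' (e ⁻¹' B) = {η | (Fin.cons y η : Fin (n + 1) → ℝ) ∈ B} :=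
    fun y ↦ by ext η; simp [hcons]
  have hmeas := measurable_measure_prodMk_left (ν := Measure.pi fun j : Fin n ↦ μ j.succ) hpre
  simp only [hset] at hmeas
  constructor
  · exact Integrable.of_bound hmeas.ennreal_toReal.aestronglyMeasurable 1
      (ae_of_all _ fun y ↦ abs_measureReal_le_one _ _)
  · rw [← hmp.measureReal_preimage hB.nullMeasurableSet]
    change ((μ 0).prod (Measure.pi fun j : Fin n ↦ μ j.succ)).real (e ⁻¹' B) = _
    rw [measureReal_def, Measure.prod_apply hpre]
    simp only [hset, measureReal_def]
    rw [integral_toReal hmeas.aemeasurable (ae_of_all _ fun y ↦ measure_lt_top _ _)]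

lemma measurableSet_forall_lt {ι κ : Type*} [Countable κ] [Fintype ι] (p : ι → κ → Prop)
    [∀ j k, Decidable (p j k)] (a b : κ → ℝ) (c : ι → ℝ) :
    MeasurableSet {ξ : ι → ℝ | ∀ k, a k < b k + ∑ j, if p j k then ξ j - c j else 0} := by
  rw [Set.ofPred_forall]
  refine MeasurableSet.iInter fun k ↦ measurableSet_lt measurable_const
    (measurable_const.add (Finset.measurable_sum _ fun j _ ↦ ?_))
  split_ifs
  · fun_prop
  · exact measurable_const

/-- A random walk with Gaussian steps, killed when it falls below a line of slope `c`, survives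
with at least the probability of the Brownian motion it is sampled from. -/
lemma survivalFun_le_pi_real (c : ℝ) : ∀ (n : ℕ) (d : Fin n → ℝ≥0) (x : ℝ), 0 < x →
    survivalFun c x (∑ j, d j) ≤ (Measure.pi fun j ↦ gaussianReal 0 (d j)).real
      {ξ | ∀ k, 0 < x + ∑ j, if j ≤ k then ξ j - c * d j else 0} := by
  intro n
  induction n with
  | zero =>
    intro d x hx
    refine (survivalFun_le_one _ _ _).trans ?_
    simp
  | succ n ih =>
    intro d x hx
    obtain ⟨hi, he⟩ := pi_real_succ (fun j ↦ gaussianReal 0 (d j))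
      (measurableSet_forall_lt (fun j k ↦ j ≤ k) (fun _ ↦ 0) (fun _ ↦ x) fun j ↦ c * d j)
    rw [he]
    have hshift : gaussianReal (-(c * d 0)) (d 0)
        = (gaussianReal 0 (d 0)).map (fun y ↦ y - c * d 0) := by
      rw [gaussianReal_map_sub_const, zero_sub]
    have hint := survivalFun_integrable c x (d 0) (∑ j : Fin n, d j.succ)
    rw [Fin.sum_univ_succ, ← integral_survivalFun]
    rw [hshift] at hint ⊢
    rw [integral_map (by fun_prop) hint.aestronglyMeasurable]
    have hint' := hint.comp_measurable (by fun_prop : Measurable fun y ↦ y - c * (d 0 : ℝ))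
    refine integral_mono hint' hi fun y ↦ ?_
    -- If the first step kills the walk, the survival function there is nonpositive and the bound is
    -- trivial; otherwise the induction hypothesis applies from the new height.
    rcases le_or_gt (x + (y - c * d 0)) 0 with h | h
    · exact (survivalFun_nonpos c h _).trans measureReal_nonneg
    · refine (ih (fun j ↦ d j.succ) _ h).trans (measureReal_mono fun η hη k ↦ ?_)
      rw [Fin.sum_univ_succ]
      refine Fin.cases ?_ (fun k ↦ ?_) k
      · simpa [Fin.succ_ne_zero] using h
      · have := hη k
        simpa [add_assoc] using this

/-- The first step places the walk at `y`; when y > U, the later steps form a walk started at height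
y - U above the line. Subtracting `d 0` measures time from the end of the first step. -/
lemma setIntegral_survivalFun_le_pi_real (c U : ℝ) {N : ℕ} (d : Fin (N + 1) → ℝ≥0) :
    ∫ y in Set.Ioi U, survivalFun c (y - U) (∑ j : Fin N, d j.succ) ∂gaussianReal 0 (d 0)
      ≤ (Measure.pi fun j ↦ gaussianReal 0 (d j)).real
        {ξ | ∀ k, U + c * ((∑ j, if j ≤ k then (d j : ℝ) else 0) - d 0)
          < ∑ j, if j ≤ k then ξ j else 0} := by
  have hB := measurableSet_forall_lt (ι := Fin (N + 1)) (fun j k ↦ j ≤ k)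
    (fun k ↦ U + c * ((∑ j, if j ≤ k then (d j : ℝ) else 0) - d 0)) (fun _ ↦ 0) fun _ ↦ 0
  simp only [zero_add, sub_zero] at hB
  obtain ⟨hi, he⟩ := pi_real_succ (fun j ↦ gaussianReal 0 (d j)) hB
  rw [he, ← integral_indicator measurableSet_Ioi]
  refine integral_mono_of_nonneg (ae_of_all _ fun y ↦ ?_) hi (ae_of_all _ fun y ↦ ?_)
  · refine Set.indicator_nonneg (fun y hy ↦ survivalFun_nonneg c ?_ _) y
    have : U < y := hy
    linarith
  · refine Set.indicator_apply_le' (fun hy ↦ ?_) fun _ ↦ measureReal_nonneg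
    have hy' : U < y := hy
    refine (survivalFun_le_pi_real c N (fun j ↦ d j.succ) (y - U) (by linarith)).trans
      (measureReal_mono fun η hη k ↦ ?_)
    refine Fin.cases ?_ (fun k ↦ ?_) k
    · simpa [Fin.sum_univ_succ, Fin.succ_ne_zero] using hy'
    · have h1 := hη k
      have h2 : (∑ j, if j ≤ k then η j - c * d j.succ else 0)
          = (∑ j, if j ≤ k then η j else 0) - c * ∑ j, if j ≤ k then (d j.succ : ℝ) else 0 := by
        rw [Finset.mul_sum, ← Finset.sum_sub_distrib]
        refine Finset.sum_congr rfl fun j _ ↦ ?_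
        split_ifs <;> simp
      rw [h2] at h1
      simp [Fin.sum_univ_succ]
      linarith

/-- Partial sums, as a continuous linear map. -/
noncomputable def partialSums (n : ℕ) : (Fin n → ℝ) →L[ℝ] (Fin n → ℝ) :=
  ContinuousLinearMap.pi fun k ↦ ∑ j with j ≤ k, ContinuousLinearMap.proj j

lemma partialSums_apply {n : ℕ} (ξ : Fin n → ℝ) (k : Fin n) :
    partialSums n ξ k = ∑ j, if j ≤ k then ξ j else 0 := by
  rw [← Finset.sum_filter]
  simp [partialSums]

instance isGaussian_pi_gaussianReal {n : ℕ} (d : Fin n → ℝ≥0) :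
    IsGaussian (Measure.pi fun j ↦ gaussianReal 0 (d j)) := by
  have hX : ∀ j, HasGaussianLaw (fun ξ : Fin n → ℝ ↦ ξ j)
      (Measure.pi fun j ↦ gaussianReal 0 (d j)) := fun j ↦ by
    refine ⟨?_⟩
    have : (Measure.pi fun j ↦ gaussianReal 0 (d j)).map (fun ξ : Fin n → ℝ ↦ ξ j)
        = gaussianReal 0 (d j) :=
      (measurePreserving_eval (fun j ↦ gaussianReal 0 (d j)) j).map_eq
    rw [this]
    infer_instance
  have h := iIndepFun.hasGaussianLaw (E := fun _ ↦ ℝ) hX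
    (iIndepFun_pi (μ := fun j ↦ gaussianReal 0 (d j)) (X := fun (_ : Fin n) (x : ℝ) ↦ x)
      fun j ↦ aemeasurable_id)
  have := h.isGaussian_map
  rwa [Measure.map_id'] at this

lemma integral_pi_gaussianReal {n : ℕ} (d : Fin n → ℝ≥0) (i : Fin n) :
    ∫ ξ, ξ i ∂(Measure.pi fun j ↦ gaussianReal 0 (d j)) = 0 := by
  have := integral_comp_eval (μ := fun j ↦ gaussianReal 0 (d j)) (i := i) (f := fun x : ℝ ↦ x)
    (by fun_prop)
  rw [this, integral_id_gaussianReal]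

lemma integral_mul_pi_gaussianReal {n : ℕ} (d : Fin n → ℝ≥0) (i j : Fin n) :
    ∫ ξ, ξ i * ξ j ∂(Measure.pi fun j ↦ gaussianReal 0 (d j)) = if i = j then (d i : ℝ) else 0 := by
  split_ifs with h
  · subst h
    have := integral_comp_eval (μ := fun j ↦ gaussianReal 0 (d j)) (i := i)
      (f := fun x : ℝ ↦ x * x) (by fun_prop)
    rw [this]
    have h1 := variance_id_gaussianReal (μ := 0) (v := d i)
    rw [variance_eq_sub (memLp_id_gaussianReal 2)] at h1
    simp only [id_eq, integral_id_gaussianReal, Pi.pow_apply, pow_two] at h1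
    simpa using h1
  · have hind := (iIndepFun_pi (μ := fun j ↦ gaussianReal 0 (d j))
      (X := fun (_ : Fin n) (x : ℝ) ↦ x) fun j ↦ aemeasurable_id).indepFun h
    have := hind.integral_fun_mul_eq_mul_integral
      (measurable_pi_apply i).aestronglyMeasurable (measurable_pi_apply j).aestronglyMeasurable
    rw [this, integral_pi_gaussianReal, zero_mul]

/-- The law of a centered Gaussian random walk whose steps have variances `d`. -/
noncomputable def walkLaw {n : ℕ} (d : Fin n → ℝ≥0) : Measure (Fin n → ℝ) :=
  (Measure.pi fun j ↦ gaussianReal 0 (d j)).map (partialSums n)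

instance isGaussian_walkLaw {n : ℕ} (d : Fin n → ℝ≥0) : IsGaussian (walkLaw d) := by
  rw [walkLaw]; infer_instance

lemma integral_walkLaw {n : ℕ} (d : Fin n → ℝ≥0) (k : Fin n) : ∫ x, x k ∂walkLaw d = 0 := by
  rw [walkLaw, integral_map (by fun_prop)
    (by exact (measurable_pi_apply k).aestronglyMeasurable)]
  simp only [partialSums_apply]
  have hi : ∀ j, Integrable (fun ξ : Fin n → ℝ ↦ if j ≤ k then ξ j else 0)
      (Measure.pi fun j ↦ gaussianReal 0 (d j)) := fun j ↦ by
    split_ifs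
    · exact integrable_coord j
    · exact integrable_zero _ _ _
  rw [integral_finsetSum _ fun j _ ↦ hi j]
  refine Finset.sum_eq_zero fun j _ ↦ ?_
  split_ifs
  · exact integral_pi_gaussianReal d j
  · simp

lemma integral_mul_walkLaw {n : ℕ} (d : Fin n → ℝ≥0) {k l : Fin n} (hkl : k ≤ l) :
    ∫ x, x k * x l ∂walkLaw d = ∑ j, if j ≤ k then (d j : ℝ) else 0 := by
  rw [walkLaw, integral_map (by fun_prop) (by fun_prop)]
  simp only [partialSums_apply, Finset.sum_mul_sum]
  have hi : ∀ i j, Integrable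
      (fun ξ : Fin n → ℝ ↦ (if i ≤ k then ξ i else 0) * if j ≤ l then ξ j else 0)
      (Measure.pi fun j ↦ gaussianReal 0 (d j)) := fun i j ↦ by
    split_ifs
    · exact integrable_coord_mul i j
    all_goals simp
  rw [integral_finsetSum _ fun i _ ↦ integrable_finsetSum _ fun j _ ↦ hi i j]
  refine Finset.sum_congr rfl fun i _ ↦ ?_
  rw [integral_finsetSum _ fun j _ ↦ hi i j]
  split_ifs with hik
  · rw [Finset.sum_eq_single i]
    · simp only [if_pos (hik.trans hkl)]
      rw [integral_mul_pi_gaussianReal, if_pos rfl]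
    · intro j _ hj
      split_ifs
      · rw [integral_mul_pi_gaussianReal, if_neg hj.symm]
      · simp
    · simp
  · simp

lemma setIntegral_survivalFun_le_walkLaw (c U : ℝ) {N : ℕ} (d : Fin (N + 1) → ℝ≥0) :
    ∫ y in Set.Ioi U, survivalFun c (y - U) (∑ j : Fin N, d j.succ) ∂gaussianReal 0 (d 0)
      ≤ (walkLaw d).real
        {x | ∀ k, U + c * ((∑ j, if j ≤ k then (d j : ℝ) else 0) - d 0) < x k} := by
  refine (setIntegral_survivalFun_le_pi_real c U d).trans_eq ?_
  rw [walkLaw, map_measureReal_apply (by fun_prop)]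
  · congr 1
    ext ξ
    simp only [Set.mem_preimage, Set.mem_ofPred_eq, partialSums_apply]
  · rw [Set.ofPred_forall]
    exact MeasurableSet.iInter fun i ↦ measurableSet_lt measurable_const (measurable_pi_apply i)

end Walk

/-! ### Lower bound for the crossing probability at high levels -/

section TailAsymptotics

lemma integral_pow_mul_exp (n : ℕ) {l : ℝ} (hl : 0 < l) :
    ∫ x in Set.Ioi (0 : ℝ), x ^ n * Real.exp (-(l * x)) = n.factorial / l ^ (n + 1) := by
  have h := Real.integral_rpow_mul_exp_neg_mul_Ioi (a := n + 1) (by positivity) hl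
  rw [Real.Gamma_nat_eq_factorial] at h
  simp only [add_sub_cancel_right, Real.rpow_natCast] at h
  rw [h, ← Nat.cast_succ, Real.rpow_natCast, one_div, inv_pow, Nat.succ_eq_add_one]
  field_simp

lemma integrableOn_pow_mul_exp (n : ℕ) {l : ℝ} (hl : 0 < l) :
    IntegrableOn (fun x ↦ x ^ n * Real.exp (-(l * x))) (Set.Ioi 0) := by
  refine Integrable.of_integral_ne_zero ?_
  rw [integral_pow_mul_exp n hl]
  positivity

lemma gaussianPDFReal_add_eq {v : ℝ≥0} (hv : v ≠ 0) (U x : ℝ) :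
    gaussianPDFReal 0 v (x + U) = gaussianPDFReal 0 v U * (Real.exp (-(U / v * x)) *
      Real.exp (-(x ^ 2 / (2 * v)))) := by
  have hv0 : (v : ℝ) ≠ 0 := by exact_mod_cast hv
  simp only [gaussianPDFReal_def]
  rw [← Real.exp_add, mul_assoc _ (Real.exp _) (Real.exp _), ← Real.exp_add]
  congr 2
  field_simp
  ring

lemma gaussianTail_le {v : ℝ≥0} (hv : v ≠ 0) {U : ℝ} (hU : 0 < U) :
    gaussianTail (U / √v) ≤ gaussianPDFReal 0 v U * (v / U) := by
  have hv0 : 0 < (v : ℝ) := NNReal.coe_pos.2 (pos_iff_ne_zero.2 hv)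
  have hl : 0 < U / v := by positivity
  have h1 := gaussianReal_real_Ioi_eq_gaussianTail 0 hv U
  rw [sub_zero] at h1
  have h2 := integral_pow_mul_exp 0 hl
  simp only [pow_zero, one_mul, zero_add, pow_one, Nat.factorial_zero, Nat.cast_one,
    one_div_div] at h2
  have h3 := integrableOn_pow_mul_exp 0 hl
  simp only [pow_zero, one_mul] at h3
  rw [← h1, gaussianReal_real_Ioi 0 hv, ← h2, ← integral_const_mul]
  refine setIntegral_mono_on ((integrable_gaussianPDFReal _ _).comp_add_right U).integrableOn
    (h3.const_mul _) measurableSet_Ioi fun x hx ↦ ?_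
  rw [gaussianPDFReal_add_eq hv]
  refine mul_le_mul_of_nonneg_left ?_ (gaussianPDFReal_nonneg _ _ _)
  refine mul_le_of_le_one_right (Real.exp_pos _).le ?_
  rw [Real.exp_le_one_iff, neg_nonpos]
  positivity

/-- Explicit lower bound for the probability that a Brownian motion lies above an affine boundary
on an interval, where `U` is the level of the boundary at the left end point. -/
noncomputable def crossingBound (c : ℝ) (v t : ℝ≥0) (U : ℝ) : ℝ :=
  gaussianPDFReal 0 v U * (constK c t * ((U / v) ^ 2)⁻¹ - 2 * survivalErr c t * ((U / v) ^ 3)⁻¹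
    - 3 * constK c t / v * ((U / v) ^ 4)⁻¹)

/-- After the shift y = U + x the density is p(U) exp(-lx) exp(-x²/(2v)) with l = U / v, and
`survivalFun_ge` reduces the integral to moments of exp(-lx). -/
lemma crossingBound_le {c : ℝ} (hc : 0 ≤ c) {v t : ℝ≥0} (hv : v ≠ 0) (ht : t ≠ 0) {U : ℝ}
    (hU : 0 < U) : crossingBound c v t U
      ≤ ∫ y in Set.Ioi U, survivalFun c (y - U) t ∂gaussianReal 0 v := by
  have hv0 : 0 < (v : ℝ) := NNReal.coe_pos.2 (pos_iff_ne_zero.2 hv)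
  have hl : 0 < U / v := by positivity
  have hK := (constK_pos c ht).le
  have hM := survivalErr_nonneg c t
  set l := U / v with hldef
  set K := constK c t
  set M := survivalErr c t
  set p := gaussianPDFReal 0 v U
  have hp : 0 ≤ p := gaussianPDFReal_nonneg _ _ _
  rw [gaussianReal_of_var_ne_zero 0 hv, setIntegral_withDensity_eq_setIntegral_toReal_smul
    (measurable_gaussianPDF 0 v) (ae_of_all _ fun _ ↦ gaussianPDF_lt_top) _ measurableSet_Ioi,
    setIntegral_Ioi_eq_shift]
  simp only [toReal_gaussianPDF, smul_eq_mul, add_sub_cancel_right]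
  have i1 := (integrableOn_pow_mul_exp 1 hl).const_mul (p * K)
  have i2 := (integrableOn_pow_mul_exp 2 hl).const_mul (p * M)
  have i3 := (integrableOn_pow_mul_exp 3 hl).const_mul (p * (K / (2 * v)))
  have i12 : IntegrableOn (fun x ↦ p * K * (x ^ 1 * Real.exp (-(l * x)))
      - p * M * (x ^ 2 * Real.exp (-(l * x)))) (Set.Ioi 0) := i1.sub i2
  -- The moments n! / l^(n + 1) for n = 1, 2, 3 produce the coefficients K, 2M and 6K / (2v) = 3K /
  -- v.
  have e : crossingBound c v t U = ∫ x in Set.Ioi (0 : ℝ), (p * K * (x ^ 1 * Real.exp (-(l * x)))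
      - p * M * (x ^ 2 * Real.exp (-(l * x)))
      - p * (K / (2 * v)) * (x ^ 3 * Real.exp (-(l * x)))) := by
    rw [integral_sub i12 i3, integral_sub i1 i2, integral_const_mul, integral_const_mul,
      integral_const_mul, integral_pow_mul_exp 1 hl, integral_pow_mul_exp 2 hl,
      integral_pow_mul_exp 3 hl, crossingBound]
    change p * (K * (l ^ 2)⁻¹ - 2 * M * (l ^ 3)⁻¹ - 3 * K / v * (l ^ 4)⁻¹) = _
    simp only [Nat.factorial]
    push_cast
    field_simp
    ring
  rw [e]
  refine setIntegral_mono_on (i12.sub i3) ?_ measurableSet_Ioi fun x hx ↦ ?_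
  · have hm : Measurable fun x ↦ survivalFun c x t := by
      unfold survivalFun
      have := measurable_real_Ioi (gaussianReal (-(c * t)) t)
      exact (this.comp measurable_neg).sub ((by fun_prop : Measurable fun x ↦
        Real.exp (2 * c * x)).mul this)
    refine Integrable.mul_bdd (c := 1) (((integrable_gaussianPDFReal _ _).comp_add_right
      U).integrableOn) hm.aestronglyMeasurable ?_
    refine (ae_restrict_iff' measurableSet_Ioi).2 (ae_of_all _ fun x hx ↦ ?_)
    rw [Real.norm_of_nonneg (survivalFun_nonneg c (le_of_lt hx) t)]
    exact survivalFun_le_one c x t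
  · have hx0 : 0 < x := hx
    have h1 := survivalFun_ge hc hx0.le ht
    have h0 := survivalFun_nonneg c hx0.le t
    have e1 : p * K * (x ^ 1 * Real.exp (-(l * x))) - p * M * (x ^ 2 * Real.exp (-(l * x)))
      - p * (K / (2 * v)) * (x ^ 3 * Real.exp (-(l * x)))
      = p * (Real.exp (-(l * x)) * (K * x - M * x ^ 2 - K * x * (x ^ 2 / (2 * v)))) := by
      field_simp
    rw [e1, gaussianPDFReal_add_eq hv, mul_assoc (gaussianPDFReal 0 v U),
      mul_assoc (Real.exp (-(U / v * x)))]
    refine mul_le_mul_of_nonneg_left (mul_le_mul_of_nonneg_left ?_ (Real.exp_pos _).le) hp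
    have h2 := Real.add_one_le_exp (-(x ^ 2 / (2 * (v : ℝ))))
    set q := x ^ 2 / (2 * (v : ℝ))
    have hq : 0 ≤ q := by positivity
    have hE1 : Real.exp (-q) ≤ 1 := by rw [Real.exp_le_one_iff]; linarith
    have hE0 := Real.exp_pos (-q)
    have hKx : 0 ≤ K * x := by positivity
    have hMx : 0 ≤ M * x ^ 2 := by positivity
    calc K * x - M * x ^ 2 - K * x * q ≤ Real.exp (-q) * (K * x - M * x ^ 2) := by nlinarith
      _ ≤ Real.exp (-q) * survivalFun c x t := mul_le_mul_of_nonneg_left h1 hE0.le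

lemma continuousAt_crossingBound (c : ℝ) {v : ℝ≥0} (hv : v ≠ 0) (t : ℝ≥0) {U : ℝ} (hU : 0 < U) :
    ContinuousAt (crossingBound c v t) U := by
  have hv0 : (v : ℝ) ≠ 0 := by exact_mod_cast hv
  have h1 : ContinuousAt (gaussianPDFReal 0 v) U := (hasDerivAt_gaussianPDFReal 0 v U).continuousAt
  have hl : U / (v : ℝ) ≠ 0 := div_ne_zero hU.ne' hv0
  unfold crossingBound
  have h2 : ∀ n : ℕ, ContinuousAt (fun U : ℝ ↦ ((U / v) ^ n)⁻¹) U := fun n ↦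
    ContinuousAt.inv₀ (by fun_prop) (pow_ne_zero _ hl)
  exact h1.mul (((continuousAt_const.mul (h2 2)).sub (continuousAt_const.mul (h2 3))).sub
    (continuousAt_const.mul (h2 4)))

end TailAsymptotics

/-! ### Superadditivity -/

section Convex

/-- A convex function on `[0, ∞)` vanishing at `0` is superadditive. -/
lemma superadditive_of_convexOn {V : ℝ → ℝ} (hV : ConvexOn ℝ (Set.Ici 0) V) (h0 : V 0 = 0)
    {a b : ℝ} (ha : 0 ≤ a) (hb : 0 ≤ b) : V a + V b ≤ V (a + b) := by
  rcases (add_nonneg ha hb).eq_or_lt with h | h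
  · have ha' : a = 0 := by linarith
    have hb' : b = 0 := by linarith
    simp [ha', hb', h0]
  · have key : ∀ x, 0 ≤ x → x ≤ a + b → V x ≤ x / (a + b) * V (a + b) := by
      intro x hx hxab
      have hq : 0 ≤ x / (a + b) := by positivity
      have hq1 : 0 ≤ 1 - x / (a + b) := sub_nonneg.2 ((div_le_one h).2 hxab)
      have := hV.2 (Set.self_mem_Ici (a := (0 : ℝ))) (Set.mem_Ici.2 h.le) hq1 hq (by ring)
      simpa [h0, div_mul_cancel₀ _ h.ne'] using this
    have h1 := key a ha (by linarith)
    have h2 := key b hb (by linarith)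
    have h3 : a / (a + b) * V (a + b) + b / (a + b) * V (a + b) = V (a + b) := by
      field_simp
    linarith

end Convex

/-! ### From a dyadic grid to the whole time interval -/

section Path

/-- The infimum is at most its term at t = S, and compactness makes that supremum attained, so
strictness survives. Continuity also supplies the boundedness that real infima and suprema need. -/
lemma iInf_iSup_neg {f : ℝ≥0 → ℝ} (hf : Continuous f) {S T : ℝ≥0}
    (h : ∀ s ∈ Set.Icc S (S + T), f s < 0) :
    (⨅ t : Set.Icc (0 : ℝ≥0) S, ⨆ s : Set.Icc (t : ℝ≥0) ((t : ℝ≥0) + T), f s) < 0 := by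
  have bdd : ∀ t : ℝ≥0, BddAbove (Set.range fun s : Set.Icc t (t + T) ↦ f s) := fun t ↦ by
    have := (isCompact_Icc (a := t) (b := t + T)).bddAbove_image hf.continuousOn
    rwa [Set.image_eq_range] at this
  have mem : ∀ t : ℝ≥0, t ∈ Set.Icc t (t + T) := fun t ↦ ⟨le_rfl, le_self_add⟩
  refine (ciInf_le ?_ (⟨S, zero_le, le_rfl⟩ : Set.Icc (0 : ℝ≥0) S)).trans_lt ?_
  · obtain ⟨m, hm⟩ := (isCompact_Icc (a := (0 : ℝ≥0)) (b := S)).bddBelow_image hf.continuousOn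
    refine ⟨m, ?_⟩
    rintro _ ⟨t, rfl⟩
    exact (hm (Set.mem_image_of_mem f t.2)).trans
      (le_ciSup (bdd t) (⟨t, mem t⟩ : Set.Icc (t : ℝ≥0) ((t : ℝ≥0) + T)))
  · obtain ⟨x, hx, hmax⟩ := (isCompact_Icc (a := S) (b := S + T)).exists_isMaxOn
      ⟨S, mem S⟩ hf.continuousOn
    have : Nonempty (Set.Icc S (S + T)) := ⟨⟨S, mem S⟩⟩
    exact (ciSup_le fun s ↦ hmax s.2).trans_lt (h x hx)

/-- The points `S + T k / 2 ^ n` of the dyadic grid of `[S, S + T]`. -/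
noncomputable def dyadicGrid (S T : ℝ≥0) (n k : ℕ) : ℝ≥0 := S + T * (k / 2 ^ n)

lemma dyadicGrid_zero (S T : ℝ≥0) (n : ℕ) : dyadicGrid S T n 0 = S := by simp [dyadicGrid]

lemma dyadicGrid_last (S T : ℝ≥0) (n : ℕ) : dyadicGrid S T n (2 ^ n) = S + T := by
  simp [dyadicGrid]

lemma dyadicGrid_two_mul (S T : ℝ≥0) (n k : ℕ) :
    dyadicGrid S T (n + 1) (2 * k) = dyadicGrid S T n k := by
  simp only [dyadicGrid, pow_succ]
  push_cast
  congr 2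
  rw [mul_comm, mul_div_mul_right _ _ two_ne_zero]

lemma monotone_dyadicGrid (S T : ℝ≥0) (n : ℕ) : Monotone (dyadicGrid S T n) := fun j k h ↦ by
  have : (j : ℝ≥0) ≤ k := by exact_mod_cast h
  simp only [dyadicGrid]
  gcongr

lemma le_of_forall_dyadicGrid {f g : ℝ≥0 → ℝ} (hf : Continuous f) (hg : Continuous g)
    {S T : ℝ≥0} (h : ∀ n k, k ≤ 2 ^ n → f (dyadicGrid S T n k) ≤ g (dyadicGrid S T n k))
    {s : ℝ≥0} (hs : s ∈ Set.Icc S (S + T)) : f s ≤ g s := by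
  rcases eq_or_ne T 0 with rfl | hT
  · have : s = S := le_antisymm (by simpa using hs.2) hs.1
    rw [this]
    simpa [dyadicGrid] using h 0 0 (by simp)
  have hT0 : 0 < T := pos_iff_ne_zero.2 hT
  set q : ℝ≥0 := (s - S) / T with hq
  have hq1 : q ≤ 1 := by
    rw [hq, div_le_one₀ hT0]
    exact tsub_le_iff_left.2 hs.2
  have hsq : S + T * q = s := by
    rw [hq, mul_div_cancel₀ _ hT, add_tsub_cancel_of_le hs.1]
  -- Rounding the relative position `q` of `s` down to the dyadic grid gives grid points converging
  -- to `s`.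
  have lim : Tendsto (fun n : ℕ ↦ dyadicGrid S T n ⌊q * 2 ^ n⌋₊) atTop (𝓝 s) := by
    have h1 := (tendsto_nat_floor_mul_div_atTop (R := ℝ) q.2).comp
      (tendsto_pow_atTop_atTop_of_one_lt (one_lt_two (α := ℝ)))
    rw [← hsq]
    refine tendsto_const_nhds.add (Tendsto.const_mul T ?_)
    rw [← NNReal.tendsto_coe]
    refine h1.congr fun n ↦ ?_
    simp only [Function.comp_apply, NNReal.val_eq_coe]
    push_cast
    congr 2
  refine le_of_tendsto_of_tendsto' (hf.continuousAt.tendsto.comp lim)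
    (hg.continuousAt.tendsto.comp lim) fun n ↦ h n _ ?_
  refine Nat.floor_le_of_le ?_
  push_cast
  exact mul_le_of_le_one_left zero_le hq1

end Path

/-! ### Covariances and comparison with a walk -/

section StationaryIncrements

variable {Ω : Type*} [MeasurableSpace Ω] {P : Measure Ω} {X : ℝ≥0 → Ω → ℝ}

lemma varianceFun_coe (t : ℝ≥0) : varianceFun X P t = Var[X t; P] := by
  simp [varianceFun]

lemma varianceFun_zero (hZero : ∀ᵐ ω ∂P, X 0 ω = 0) : varianceFun X P 0 = 0 := by
  have : X 0 =ᵐ[P] fun _ ↦ 0 := hZero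
  rw [varianceFun, Real.toNNReal_zero, variance_congr this]
  exact variance_zero P

lemma isGaussian_map_family (hGauss : IsGaussianProcess X P) {n : ℕ} (τ : Fin n → ℝ≥0) :
    IsGaussian (P.map fun ω k ↦ X (τ k) ω) := by
  have h := (hGauss.comp_right τ).hasGaussianLaw Finset.univ
  have h2 := h.map (ContinuousLinearMap.pi fun k : Fin n ↦
    ContinuousLinearMap.proj (R := ℝ) (φ := fun _ : (Finset.univ : Finset (Fin n)) ↦ ℝ)
      ⟨k, Finset.mem_univ k⟩)
  exact h2.isGaussian_map

lemma variance_increment (hZero : ∀ᵐ ω ∂P, X 0 ω = 0) (hStat : HasStationaryIncrements X P)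
    {s t : ℝ≥0} (hst : s ≤ t) :
    Var[fun ω ↦ X t ω - X s ω; P] = varianceFun X P (t - s) := by
  have h := (hStat s {t - s}).comp (u := fun x ↦ x ⟨t - s, by simp⟩) (measurable_pi_apply _)
  have h1 : Var[fun ω ↦ X (t - s + s) ω - X s ω; P] = Var[fun ω ↦ X (t - s) ω - X 0 ω; P] :=
    h.variance_eq
  have h2 : (fun ω ↦ X (t - s) ω - X 0 ω) =ᵐ[P] X (t - s) := by
    filter_upwards [hZero] with ω hω
    simp [hω]
  rw [tsub_add_cancel_of_le hst, variance_congr h2, ← varianceFun_coe, NNReal.coe_sub hst] at h1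
  exact h1

variable [IsProbabilityMeasure P]

lemma integral_mul_self_eq (hGauss : IsGaussianProcess X P) (hCentered : ∀ t, ∫ ω, X t ω ∂P = 0)
    (t : ℝ≥0) : ∫ ω, X t ω * X t ω ∂P = varianceFun X P t := by
  rw [varianceFun_coe, variance_eq_sub (hGauss.hasGaussianLaw_eval t).memLp_two, hCentered]
  simp [pow_two]

lemma integral_mul_eq (hGauss : IsGaussianProcess X P) (hCentered : ∀ t, ∫ ω, X t ω ∂P = 0)
    (hZero : ∀ᵐ ω ∂P, X 0 ω = 0) (hStat : HasStationaryIncrements X P)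
    {s t : ℝ≥0} (hst : s ≤ t) :
    ∫ ω, X s ω * X t ω ∂P
      = (varianceFun X P s + varianceFun X P t - varianceFun X P (t - s)) / 2 := by
  have hs := (hGauss.hasGaussianLaw_eval s).memLp_two
  have ht := (hGauss.hasGaussianLaw_eval t).memLp_two
  have h := variance_fun_sub ht hs
  rw [variance_increment hZero hStat hst, covariance_eq_sub ht hs, hCentered, hCentered,
    ← varianceFun_coe, ← varianceFun_coe] at h
  have e : ∫ ω, (X t * X s) ω ∂P = ∫ ω, X s ω * X t ω ∂P := by
    congr 1; ext ω; simp [mul_comm]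
  rw [e] at h
  linarith

/-- Telescoping; the value at index 0 is the variance of the starting point, which also keeps the
truncated subtraction `j - 1` harmless. -/
lemma sum_increments_eq (V : ℕ → ℝ) {N : ℕ} (k : Fin (N + 1)) :
    (∑ j : Fin (N + 1), if j ≤ k then (if (j : ℕ) = 0 then V 0 else V j - V (j - 1)) else 0)
      = V k := by
  have h1 := Fin.sum_univ_eq_sum_range
    (fun j ↦ if j ≤ (k : ℕ) then (if j = 0 then V 0 else V j - V (j - 1)) else 0) (N + 1)
  simp only [Fin.le_def]
  rw [h1, ← Finset.sum_filter]
  have h2 : (Finset.range (N + 1)).filter (· ≤ (k : ℕ)) = Finset.range (k + 1) := by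
    ext j
    simp only [Finset.mem_filter, Finset.mem_range]
    omega
  rw [h2, Finset.sum_range_succ']
  simp only [Nat.add_eq_zero_iff, one_ne_zero, and_false, if_false, Nat.add_sub_cancel, if_true]
  rw [Finset.sum_range_sub]
  ring

/-- Slepian's inequality compares the process on the grid with the walk whose step variances are the
increments of V. The slope condition then places the boundary below a line in the walk's variance
clock, of slope `c / b`. -/
lemma crossingBound_le_grid (hGauss : IsGaussianProcess X P)
    (hCentered : ∀ t, ∫ ω, X t ω ∂P = 0) (hZero : ∀ᵐ ω ∂P, X 0 ω = 0)
    (hStat : HasStationaryIncrements X P) (hMono : StrictMonoOn (varianceFun X P) (Set.Ici 0))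
    (hConv : ConvexOn ℝ (Set.Ici 0) (varianceFun X P)) {c b : ℝ} (hc : 0 < c) (hb : 0 < b)
    {τ : ℕ → ℝ≥0} (hτ : Monotone τ) (hτ0 : 0 < τ 0) {N : ℕ} (hτN : τ 0 < τ N)
    (hslope : ∀ t, τ 0 ≤ t →
      b * ((t : ℝ) - τ 0) ≤ varianceFun X P t - varianceFun X P (τ 0))
    {a ε : ℝ} (ha : 0 < a) (hε : 0 < ε) :
    crossingBound (c / b) (varianceFun X P (τ 0)).toNNReal
        (varianceFun X P (τ N) - varianceFun X P (τ 0)).toNNReal (a + c * τ 0 + ε)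
      ≤ P.real {ω | ∀ k : Fin (N + 1), a + c * τ k < X (τ k) ω} := by
  set V := varianceFun X P with hV
  have V0 : V 0 = 0 := varianceFun_zero hZero
  have hmonoV : ∀ s t : ℝ≥0, s ≤ t → V s ≤ V t := fun s t h ↦
    hMono.monotoneOn s.2 t.2 (by exact_mod_cast h)
  have hVnn : ∀ s : ℝ≥0, 0 ≤ V s := fun s ↦ by
    rw [hV, varianceFun_coe]; exact variance_nonneg _ _
  have hV0 : 0 < V (τ 0) := by
    rw [← V0]; exact hMono (by simp) (τ 0).2 (by exact_mod_cast hτ0)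
  have hVN : 0 < V (τ N) - V (τ 0) :=
    sub_pos.2 (hMono (τ 0).2 (τ N).2 (by exact_mod_cast hτN))
  set W : ℕ → ℝ := fun j ↦ V (τ j) with hW
  set d : Fin (N + 1) → ℝ≥0 := fun j ↦
    (if (j : ℕ) = 0 then W 0 else W j - W (j - 1)).toNNReal with hd
  have hdcoe : ∀ j, (d j : ℝ) = if (j : ℕ) = 0 then W 0 else W j - W (j - 1) := fun j ↦ by
    refine Real.coe_toNNReal _ ?_
    split_ifs
    · exact hV0.le
    · exact sub_nonneg.2 (hmonoV _ _ (hτ (by omega)))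
  have hsum : ∀ k : Fin (N + 1), (∑ j, if j ≤ k then (d j : ℝ) else 0) = W k := fun k ↦ by
    simp only [hdcoe]
    exact sum_increments_eq W k
  have hd0 : d 0 = (V (τ 0)).toNNReal := by simp [hd, hW]
  have hdcoe0 : (d 0 : ℝ) = V (τ 0) := by rw [hdcoe]; simp [hW]
  have hdtot : ∑ j : Fin N, d j.succ = (V (τ N) - V (τ 0)).toNNReal := by
    apply NNReal.eq
    rw [Real.coe_toNNReal _ hVN.le]
    have h1 := hsum (Fin.last N)
    simp only [Fin.le_last, if_true, Fin.val_last] at h1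
    rw [Fin.sum_univ_succ, hdcoe0] at h1
    push_cast
    linarith
  set μ := P.map fun ω (k : Fin (N + 1)) ↦ X (τ k) ω with hμdef
  have hμG : IsGaussian μ := isGaussian_map_family hGauss fun k : Fin (N + 1) ↦ τ k
  have hXm : ∀ t, AEMeasurable (X t) P := hGauss.aemeasurable
  have hfam : AEMeasurable (fun ω (k : Fin (N + 1)) ↦ X (τ k) ω) P :=
    aemeasurable_pi_lambda _ fun k ↦ hXm _
  have hμmean : ∀ k, ∫ x, x k ∂μ = 0 := fun k ↦ by
    rw [hμdef, integral_map hfam (by exact (measurable_pi_apply k).aestronglyMeasurable)]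
    exact hCentered _
  have hμcov : ∀ k l, ∫ x, x k * x l ∂μ = ∫ ω, X (τ k) ω * X (τ l) ω ∂P := fun k l ↦ by
    rw [hμdef, integral_map hfam (by
      exact ((measurable_pi_apply k).mul (measurable_pi_apply l)).aestronglyMeasurable)]
  have hdiag : ∀ k, ∫ x, x k * x k ∂μ = ∫ x, x k * x k ∂walkLaw d := fun k ↦ by
    rw [hμcov, integral_mul_self_eq hGauss hCentered, integral_mul_walkLaw d le_rfl, hsum]
  have hcov' : ∀ k l, k ≤ l → ∫ x, x k * x l ∂walkLaw d ≤ ∫ x, x k * x l ∂μ := by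
    intro k l hkl
    have hτkl : τ k ≤ τ l := hτ hkl
    rw [hμcov, integral_mul_walkLaw d hkl, hsum,
      integral_mul_eq hGauss hCentered hZero hStat hτkl]
    -- Superadditivity V(s) + V(t - s) ≤ V(t) is exactly the statement that the covariance of X
    -- dominates that of the walk.
    have h1 := superadditive_of_convexOn hConv V0 (a := τ k) (b := (τ l : ℝ) - τ k) (τ k).2
      (sub_nonneg.2 (by exact_mod_cast hτkl))
    rw [add_sub_cancel] at h1
    change V (τ k) ≤ (V (τ k) + V (τ l) - V (τ l - τ k)) / 2
    linarith
  have hcov : ∀ k l, ∫ x, x k * x l ∂walkLaw d ≤ ∫ x, x k * x l ∂μ := by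
    intro k l
    rcases le_total k l with h | h
    · exact hcov' k l h
    · simpa only [mul_comm] using hcov' l k h
  have hU : 0 < a + c * τ 0 + ε := by positivity
  have step1 := crossingBound_le (c := c / b) (by positivity)
    (v := (V (τ 0)).toNNReal) (t := (V (τ N) - V (τ 0)).toNNReal)
    (Real.toNNReal_pos.2 hV0).ne' (Real.toNNReal_pos.2 hVN).ne' hU
  have step2 := setIntegral_survivalFun_le_walkLaw (c / b) (a + c * τ 0 + ε) d
  rw [hdtot, hd0] at step2
  have step3 := slepian hμmean (integral_walkLaw d) hdiag hcov
    (fun k : Fin (N + 1) ↦ a + c * τ k) hε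
  refine step1.trans (step2.trans ((measureReal_mono fun x hx k ↦ ?_).trans (step3.trans_eq ?_)))
  · have h1 := hx k
    rw [hsum, Real.coe_toNNReal _ hV0.le] at h1
    have h2 := hslope (τ k) (hτ (Nat.zero_le _))
    have h3 : c * ((τ k : ℝ) - τ 0) ≤ c / b * (V (τ k) - V (τ 0)) := by
      have := mul_le_mul_of_nonneg_left h2 (by positivity : 0 ≤ c / b)
      rw [← mul_assoc, div_mul_cancel₀ _ hb.ne'] at this
      exact this
    simp only [hW] at h1
    linarith
  · rw [hμdef, map_measureReal_apply_of_aemeasurable hfam]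
    · rfl
    · rw [Set.ofPred_forall]
      exact MeasurableSet.iInter fun i ↦ measurableSet_lt measurable_const (measurable_pi_apply i)

end StationaryIncrements

/-! ### Passage to continuous time and to the limit in u -/

section Main

variable {Ω : Type*} [MeasurableSpace Ω] {P : Measure Ω} [IsProbabilityMeasure P]
  {X : ℝ≥0 → Ω → ℝ}

/-- If every dyadic grid of `[S, S + T]` is, with probability at least `p`, such that the process
exceeds `a + c t` on it with `u < a`, then Parisian ruin has probability at least `p`. -/
lemma le_parisianRuinProb (hGauss : IsGaussianProcess X P)
    (hCont : ∀ᵐ ω ∂P, Continuous (fun t ↦ X t ω)) {c u a p : ℝ} {S T : ℝ≥0} (hua : u < a)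
    (hp : ∀ n, p ≤ P.real {ω | ∀ k : Fin (2 ^ n + 1),
      a + c * dyadicGrid S T n k < X (dyadicGrid S T n k) ω}) :
    p ≤ parisianRuinProb X P c S T u := by
  set G : ℕ → Set Ω := fun n ↦ {ω | ∀ k : Fin (2 ^ n + 1),
    a + c * dyadicGrid S T n k < X (dyadicGrid S T n k) ω} with hG
  have hmeas : ∀ n, NullMeasurableSet (G n) P := fun n ↦ by
    simp only [hG]
    rw [Set.ofPred_forall]
    exact NullMeasurableSet.iInter fun k ↦
      nullMeasurableSet_lt aemeasurable_const (hGauss.aemeasurable _)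
  -- The grids are nested: a point of index k reappears with index 2k at the next level.
  have hanti : Antitone G := antitone_nat_of_succ_le fun n ω hω k ↦ by
    have := hω ⟨2 * k, by have := k.2; rw [pow_succ]; omega⟩
    simpa only [dyadicGrid_two_mul] using this
  have lim := tendsto_measure_iInter_atTop hmeas hanti ⟨0, measure_ne_top _ _⟩
  have lim' : Tendsto (fun n ↦ P.real (G n)) atTop (𝓝 (P.real (⋂ n, G n))) :=
    (ENNReal.tendsto_toReal (measure_ne_top _ _)).comp lim
  refine (ge_of_tendsto' lim' hp).trans ?_
  refine ENNReal.toReal_mono (measure_ne_top _ _) (measure_mono_ae ?_)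
  filter_upwards [hCont] with ω hω hmem
  have hmem' : ω ∈ ⋂ n, G n := hmem
  rw [Set.mem_iInter] at hmem'
  refine iInf_iSup_neg (f := fun s ↦ surplus X c u s ω) ?_ fun s hs ↦ ?_
  · unfold surplus
    fun_prop
  -- Strictness is lost in passing from the grid to the interval, and u < a restores it.
  · have := le_of_forall_dyadicGrid (f := fun s ↦ a + c * s) (g := fun s ↦ X s ω) (by fun_prop) hω
      (fun n k hk ↦ (hmem' n ⟨k, by omega⟩).le) hs
    simp only [surplus]
    linarith

lemma crossingBound_le_parisianRuinProb (hGauss : IsGaussianProcess X P)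
    (hCentered : ∀ t, ∫ ω, X t ω ∂P = 0) (hCont : ∀ᵐ ω ∂P, Continuous (fun t ↦ X t ω))
    (hZero : ∀ᵐ ω ∂P, X 0 ω = 0)
    (hStat : HasStationaryIncrements X P) (hMono : StrictMonoOn (varianceFun X P) (Set.Ici 0))
    (hConv : ConvexOn ℝ (Set.Ici 0) (varianceFun X P)) {c b : ℝ} (hc : 0 < c) (hb : 0 < b)
    {S T : ℝ≥0} (hS : 0 < S) (hT : 0 < T)
    (hslope : ∀ t, S ≤ t → b * ((t : ℝ) - S) ≤ varianceFun X P t - varianceFun X P S)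
    {u : ℝ} (hu : 0 < u) :
    crossingBound (c / b) (varianceFun X P S).toNNReal
        (varianceFun X P (S + T) - varianceFun X P S).toNNReal (u + c * S)
      ≤ parisianRuinProb X P c S T u := by
  have hv : 0 < varianceFun X P S := by
    rw [← varianceFun_zero (X := X) hZero]
    exact hMono (by simp) S.2 (by exact_mod_cast hS)
  have key : ∀ ε, 0 < ε → crossingBound (c / b) (varianceFun X P S).toNNReal
      (varianceFun X P (S + T) - varianceFun X P S).toNNReal (u + c * S + 2 * ε)
        ≤ parisianRuinProb X P c S T u := by
    intro ε hε
    -- One ε raises the level for the passage to continuous time, the other is the slack in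
    -- Slepian's inequality. Continuity of the bound in the level removes both.
    refine le_parisianRuinProb hGauss hCont (a := u + ε) (by linarith) fun n ↦ ?_
    have h := crossingBound_le_grid hGauss hCentered hZero hStat hMono hConv hc hb
      (monotone_dyadicGrid S T n) (by rwa [dyadicGrid_zero]) (N := 2 ^ n)
      (by rw [dyadicGrid_zero, dyadicGrid_last]; exact lt_add_of_pos_right S hT)
      (by rwa [dyadicGrid_zero]) (a := u + ε) (by positivity) hε
    rw [dyadicGrid_zero, dyadicGrid_last] at h
    push_cast at h
    convert! h using 2
    ring
  have hcont := continuousAt_crossingBound (c / b) (Real.toNNReal_pos.2 hv).ne'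
    (varianceFun X P (S + T) - varianceFun X P S).toNNReal (U := u + c * S) (by positivity)
  have lim : Tendsto (fun ε : ℝ ↦ u + c * S + 2 * ε) (𝓝[>] 0) (𝓝 (u + c * S)) := by
    have : ContinuousAt (fun ε : ℝ ↦ u + c * S + 2 * ε) 0 := by fun_prop
    have h := this.tendsto
    rw [mul_zero, add_zero] at h
    exact h.mono_left nhdsWithin_le_nhds
  exact le_of_tendsto (hcont.tendsto.comp lim) (eventually_nhdsWithin_of_forall fun ε hε ↦ key ε hε)

/-- The explicit crossing bound is asymptotically `constK c t * (v / u) * Ψ(U / √v)`, where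
`U = u + s`. -/
lemma exists_crossingBound_ge {c : ℝ} {v t : ℝ≥0} (hv : v ≠ 0) (hK : 0 < constK c t)
    {s : ℝ} (hs : 0 ≤ s) :
    ∃ r : ℝ → ℝ, Tendsto r atTop (𝓝 0) ∧ ∀ᶠ u in atTop,
      constK c t * (v / u) * gaussianTail ((u + s) / √v) * (1 + r u)
        ≤ crossingBound c v t (u + s) := by
  have hv0 : 0 < (v : ℝ) := NNReal.coe_pos.2 (pos_iff_ne_zero.2 hv)
  set K := constK c t with hKdef
  set M := survivalErr c t with hMdef
  -- The quotient of `crossingBound` by K (v / u) p(U) (v / U), with U = u + s; the factor u / (u +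
  -- s) pays for writing v / u instead of v / U.
  set ρ : ℝ → ℝ := fun u ↦ u / (u + s) * (1 - 2 * M / K * (v * (u + s)⁻¹)
    - 3 / v * (v * (u + s)⁻¹) ^ 2) with hρ
  have hinv : Tendsto (fun u : ℝ ↦ (u + s)⁻¹) atTop (𝓝 0) :=
    tendsto_inv_atTop_zero.comp (tendsto_atTop_add_const_right _ s tendsto_id)
  have hratio : Tendsto (fun u : ℝ ↦ u / (u + s)) atTop (𝓝 1) := by
    have h : Tendsto (fun u : ℝ ↦ 1 - s * (u + s)⁻¹) atTop (𝓝 (1 - s * 0)) :=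
      tendsto_const_nhds.sub (hinv.const_mul s)
    rw [mul_zero, sub_zero] at h
    refine h.congr' ((eventually_gt_atTop 0).mono fun u hu ↦ ?_)
    have : u + s ≠ 0 := by positivity
    field_simp
    ring
  have hρlim : Tendsto ρ atTop (𝓝 1) := by
    have h1 := (hinv.const_mul (v : ℝ)).const_mul (2 * M / K)
    have h2 := ((hinv.const_mul (v : ℝ)).pow 2).const_mul (3 / (v : ℝ))
    have h := hratio.mul ((tendsto_const_nhds (x := (1 : ℝ))).sub h1 |>.sub h2)
    simpa using h
  refine ⟨fun u ↦ ρ u - 1, by simpa using hρlim.sub_const 1, ?_⟩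
  -- Positivity of ρ is needed to multiply the upper bound for the tail by it.
  filter_upwards [eventually_gt_atTop 0, hρlim.eventually (lt_mem_nhds one_pos)] with u hu hρu
  have hU : 0 < u + s := by positivity
  have htail := gaussianTail_le hv hU
  rw [add_sub_cancel]
  calc K * (v / u) * gaussianTail ((u + s) / √v) * ρ u
      ≤ K * (v / u) * (gaussianPDFReal 0 v (u + s) * (v / (u + s))) * ρ u := by
        gcongr
    _ = crossingBound c v t (u + s) := by
        rw [crossingBound, ← hKdef, ← hMdef, hρ]
        field_simp

end Main

end ParisianRuin

theorem theorem3p1 {Ω : Type*} [MeasurableSpace Ω] (P : Measure Ω) [IsProbabilityMeasure P]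
    (X : ℝ≥0 → Ω → ℝ)
    (hGauss : IsGaussianProcess X P)
    (hCentered : ∀ t, ∫ ω, X t ω ∂P = 0)
    (hCont : ∀ᵐ ω ∂P, Continuous (fun t ↦ X t ω))
    (hZero : ∀ᵐ ω ∂P, X 0 ω = 0)
    (hStat : ParisianRuin.HasStationaryIncrements X P)
    (hDiff : DifferentiableOn ℝ (ParisianRuin.varianceFun X P) (Set.Ici 0))
    (hMono : StrictMonoOn (ParisianRuin.varianceFun X P) (Set.Ici 0))
    (hConv : ConvexOn ℝ (Set.Ici 0) (ParisianRuin.varianceFun X P))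
    (c : ℝ) (hc : 0 < c) (S T : ℝ≥0) (hS : 0 < S) (hT : 0 < T) :
    ∃ r : ℝ → ℝ, Tendsto r atTop (𝓝 0) ∧ ∀ᶠ u in atTop,
      ParisianRuin.parisianRuinProb X P c S T u ≥
        ParisianRuin.constK (c / deriv (ParisianRuin.varianceFun X P) S)
            (ParisianRuin.varianceFun X P (S + T) - ParisianRuin.varianceFun X P S) *
          (ParisianRuin.varianceFun X P S / u) *
          ParisianRuin.gaussianTail ((u + c * S) / √(ParisianRuin.varianceFun X P S)) *
          (1 + r u) := by
  open ParisianRuin in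
  have hS' : (0 : ℝ) < S := by exact_mod_cast hS
  have hT' : (0 : ℝ) < T := by exact_mod_cast hT
  set V := varianceFun X P with hV
  have hdiffS : DifferentiableAt ℝ V S :=
    (hDiff S hS'.le).differentiableAt (Ici_mem_nhds hS')
  have V0 : V 0 = 0 := varianceFun_zero hZero
  have hvS : 0 < V S := by rw [← V0]; exact hMono (by simp) hS'.le hS'
  have hΔ : 0 < V (S + T) - V S :=
    sub_pos.2 (hMono hS'.le (by positivity : (0 : ℝ) ≤ S + T) (by linarith))
  -- Strict monotonicity alone would allow a zero derivative; by convexity V'(S) is at least the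
  -- chord slope V(S) / S > 0.
  have hb : 0 < deriv V S := by
    have h := hConv.slope_le_deriv (x := 0) (by simp) hS'.le hS' hdiffS
    rw [slope_def_field, V0] at h
    refine lt_of_lt_of_le ?_ h
    rw [sub_zero, sub_zero]
    positivity
  have hslope : ∀ t : ℝ≥0, S ≤ t → deriv V S * ((t : ℝ) - S) ≤ V t - V S := by
    intro t ht
    rcases ht.eq_or_lt with rfl | hlt
    · simp
    · have hlt' : (S : ℝ) < t := by exact_mod_cast hlt
      have h := hConv.deriv_le_slope hS'.le (hS'.trans hlt').le hlt' hdiffS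
      rw [slope_def_field, le_div_iff₀ (sub_pos.2 hlt')] at h
      exact h
  have hbound : ∀ u : ℝ, 0 < u → crossingBound (c / deriv V S) (V S).toNNReal
      (V (S + T) - V S).toNNReal (u + c * S) ≤ parisianRuinProb X P c S T u := fun u hu ↦
    crossingBound_le_parisianRuinProb hGauss hCentered hCont hZero hStat hMono hConv hc hb hS hT
      hslope hu
  have hK := constK_pos (c / deriv V S) (t := (V (S + T) - V S).toNNReal)
    (Real.toNNReal_pos.2 hΔ).ne'
  obtain ⟨r, hr, hev⟩ := exists_crossingBound_ge (v := (V S).toNNReal)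
    (Real.toNNReal_pos.2 hvS).ne' hK (s := c * S) (by positivity)
  refine ⟨r, hr, ?_⟩
  filter_upwards [hev, eventually_gt_atTop 0] with u hu hu0
  rw [Real.coe_toNNReal _ hvS.le, Real.coe_toNNReal _ hΔ.le] at hu
  exact hu.trans (hbound u hu0)
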